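/- Let $\Gamma_{32.40}$ denote the group of order $32$ generated by $a,b,c$ with central commutators $z=[a,b]$, $w=[a,c]$ and the relations $[b,c]=1$, $z^2=w^2=1$, $a^2=z$, $b^2=zw$, $c^2=w$; its commutator subgroup is $\{1,z,w,zw\}\simeq C_2\times C_2$. (This is the group with number 32.40 in the tables of groups of order $32$, also known as $\Gamma_4c_3$.) Let $k$ be a quadratic number field and let $L/k$ be a Galois extension, unramified at all finite primes, with Galois group $\Gamma=\mathrm{Gal}(L/k)\simeq\Gamma_{32.40}$. Assume that the two quaternion extensions of $k$ inside $L$, i.e. the subextensions $E/k$ of $L/k$ that are Galois with $\mathrm{Gal}(E/k)$ isomorphic to the quaternion group of order $8$, are normal over $\mathbb{Q}$. Let $K$ be the fixed field of the commutator subgroup $\Gamma'$. For a prime $p$ let $\mathrm{Cl}_p(L/K)$ be the $p$-Sylow subgroup of the relative class group $\mathrm{Cl}(L/K)$, the kernel of the norm map $N_{L/K}:\mathrm{Cl}(L)\to\mathrm{Cl}(K)$ on ideal class groups (in the wide sense), and let its rank be its minimal number of generators. Then $$\operatorname{rank}\mathrm{Cl}_p(L/K)\equiv\begin{cases}0\pmod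 2,&\text{if }p\equiv 1\pmod 4,\\ 0\pmod 4,&\text{if }p\equiv 3\pmod 4.\end{cases}$$ -/

import Mathlib

open scoped NumberField nonZeroDivisors

/-- The group `32.40` of order 32 (`Γ₄c₃` in the Hall–Senior notation): the central extension of
`(2,2,2)` by `(2,2)` with generators `a, b, c`, central commutators `z = [a,b]`, `w = [a,c]`,
and relations `z² = w² = 1`, `[b,c] = 1`, `a² = z`, `b² = z w`, `c² = w`.
It is the unique group of order 32 whose commutator subgroup is central of type `(2,2)`, with
quotient of type `(2,2,2)`, and whose quotients by the three subgroups of order 2 of the commutator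
subgroup are, in some order, `D₄ ∘ C₄`, `D₄ ∘ C₄` (central products) and `C₂ × Q₈`.

Here `a = ⟨1,0,0,0,0⟩`, `b = ⟨0,1,0,0,0⟩`, `c = ⟨0,0,1,0,0⟩`, `z = ⟨0,0,0,1,0⟩` and
`w = ⟨0,0,0,0,1⟩`, and the element `⟨i, j, l, s, t⟩` is `cˡ bʲ aⁱ zˢ wᵗ`. -/
@[ext]
structure Group32_40 where
  i : ZMod 2
  j : ZMod 2
  l : ZMod 2
  s : ZMod 2
  t : ZMod 2
deriving DecidableEq, Fintype

namespace Group32_40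

/-- The product is that of `𝔽₂³ × 𝔽₂²` twisted by a bilinear cocycle `𝔽₂³ × 𝔽₂³ → 𝔽₂²`. -/
instance : Mul Group32_40 where
  mul x y :=
    ⟨x.i + y.i, x.j + y.j, x.l + y.l,
      x.s + y.s + (x.i * y.i + x.j * y.j + x.i * y.j),
      x.t + y.t + (x.j * y.j + x.l * y.l + x.i * y.l)⟩

instance : One Group32_40 where
  one := ⟨0, 0, 0, 0, 0⟩

instance : Inv Group32_40 where
  inv x :=
    ⟨-x.i, -x.j, -x.l,
      -x.s + (x.i * x.i + x.j * x.j + x.i * x.j),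
      -x.t + (x.j * x.j + x.l * x.l + x.i * x.l)⟩

theorem mul_def (x y : Group32_40) : x * y =
    ⟨x.i + y.i, x.j + y.j, x.l + y.l,
      x.s + y.s + (x.i * y.i + x.j * y.j + x.i * y.j),
      x.t + y.t + (x.j * y.j + x.l * y.l + x.i * y.l)⟩ := rfl

theorem one_def : (1 : Group32_40) = ⟨0, 0, 0, 0, 0⟩ := rfl

theorem inv_def (x : Group32_40) : x⁻¹ =
    ⟨-x.i, -x.j, -x.l,
      -x.s + (x.i * x.i + x.j * x.j + x.i * x.j),
      -x.t + (x.j * x.j + x.l * x.l + x.i * x.l)⟩ := rfl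

instance : Group Group32_40 :=
  Group.ofLeftAxioms
    (fun x y z => by ext <;> simp only [mul_def] <;> ring)
    (fun x => by ext <;> simp [mul_def, one_def])
    (fun x => by ext <;> simp only [mul_def, inv_def, one_def] <;> ring)

open scoped commutatorElement in
/-- The defining relations, and the normal form of the elements. -/
theorem relations :
    let a : Group32_40 := ⟨1, 0, 0, 0, 0⟩
    let b : Group32_40 := ⟨0, 1, 0, 0, 0⟩
    let c : Group32_40 := ⟨0, 0, 1, 0, 0⟩
    let z : Group32_40 := ⟨0, 0, 0, 1, 0⟩
    let w : Group32_40 := ⟨0, 0, 0, 0, 1⟩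
    ⁅a, b⁆ = z ∧ ⁅a, c⁆ = w ∧ ⁅b, c⁆ = 1 ∧ a ^ 2 = z ∧ b ^ 2 = z * w ∧ c ^ 2 = w ∧
      z ^ 2 = 1 ∧ w ^ 2 = 1 ∧ (∀ x, z * x = x * z) ∧ (∀ x, w * x = x * w) ∧
      ∀ x : Group32_40,
        x = c ^ x.l.val * b ^ x.j.val * a ^ x.i.val * z ^ x.s.val * w ^ x.t.val := by
  decide

end Group32_40

section RelativeClassGroup

variable (F E : Type*) [Field F] [NumberField F] [Field E] [NumberField E] [Algebra F E]

/-- The relative norm of nonzero integral ideals in an extension `E / F` of number fields. -/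
noncomputable def idealNorm : (Ideal (𝓞 E))⁰ →* (Ideal (𝓞 F))⁰ where
  toFun I := ⟨Ideal.relNorm (𝓞 F) (I : Ideal (𝓞 E)), by
    rw [mem_nonZeroDivisors_iff_ne_zero]
    exact fun h => mem_nonZeroDivisors_iff_ne_zero.mp I.2 (Ideal.relNorm_eq_bot_iff.mp h)⟩
  map_one' := Subtype.ext (map_one (Ideal.relNorm (𝓞 F)))
  map_mul' I J := Subtype.ext (map_mul (Ideal.relNorm (𝓞 F)) (I : Ideal (𝓞 E)) J)

theorem mk0_idealNorm_eq {I J : (Ideal (𝓞 E))⁰} (h : ClassGroup.mk0 I = ClassGroup.mk0 J) :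
    ClassGroup.mk0 (idealNorm F E I) = ClassGroup.mk0 (idealNorm F E J) := by
  rw [ClassGroup.mk0_eq_mk0_iff] at h ⊢
  obtain ⟨x, y, hx, hy, hxy⟩ := h
  refine ⟨Algebra.intNorm (𝓞 F) (𝓞 E) x, Algebra.intNorm (𝓞 F) (𝓞 E) y,
    Algebra.intNorm_ne_zero.mpr hx, Algebra.intNorm_ne_zero.mpr hy, ?_⟩
  have := congrArg (Ideal.relNorm (𝓞 F)) hxy
  rwa [map_mul, map_mul, Ideal.relNorm_singleton, Ideal.relNorm_singleton] at this

/-- The homomorphism `N_{E/F} : Cl(E) → Cl(F)` of ideal class groups induced by the relative norm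
of ideals, see `classGroupNorm_mk0`. -/
noncomputable def classGroupNorm : ClassGroup (𝓞 E) →* ClassGroup (𝓞 F) :=
  MonoidHom.mk'
    (fun c => ClassGroup.mk0 (idealNorm F E (Function.surjInv ClassGroup.mk0_surjective c)))
    (fun c d => by
      rw [← map_mul, ← map_mul]
      apply mk0_idealNorm_eq
      rw [map_mul]
      simp only [Function.surjInv_eq])

theorem classGroupNorm_mk0 (I : (Ideal (𝓞 E))⁰) :
    classGroupNorm F E (ClassGroup.mk0 I) = ClassGroup.mk0 (idealNorm F E I) :=
  mk0_idealNorm_eq F E (Function.surjInv_eq _ _)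

/-- The relative class group `Cl(E/F)`: the kernel of the norm `Cl(E) → Cl(F)`. -/
noncomputable abbrev relClassGroup : Subgroup (ClassGroup (𝓞 E)) :=
  (classGroupNorm F E).ker

/-- The `p`-Sylow subgroup `Cl_p(E/F)` of the relative class group: its elements of
`p`-power order. -/
noncomputable abbrev relClassGroupPart (p : ℕ) : Subgroup (relClassGroup F E) :=
  CommGroup.primaryComponent (relClassGroup F E) p

end RelativeClassGroup

/-! Only odd `p` matters, so `V = Cl(L)[p]` is a representation of `Γ` over `𝔽_p` on which `Γ' = ⟨z,
w⟩`, of order 4, acts semisimply. The rank sought is the dimension of the kernel of `1 + z + w + zw`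
on `V` (`rank_relClassGroupPart`), which is the sum of the eigenspaces of the three nontrivial
characters of `Γ'`.

Each dimension is controlled by one principle (`finrank_dvd_of_anticommuting`). Suppose `T² = -1`,
`S² = 1`, `T` commutes with `S`, and an injective `R` anticommutes with `S`. Then `R` makes the two
eigenspaces of `S` equidimensional, and `T` makes each of them even-dimensional when `-1` is not a
square, that is, when `p ≡ 3 mod 4`. For two of the characters such operators come from `Γ` itself,
the quotient of `Γ` by the kernel of the character being `D₄ ∘ C₄`.

The third character leads to `C₂ × Q₈`, where `Γ` alone is not enough. This eigenspace splits into
the part fixed by `c` and the part fixed by `cz`, which are the parts of `Cl(E)[p]` negated by `z`,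
for `E` the two quaternion extensions (`dim_quaternionPart_eq`). Here normality over `ℚ` enters: `ℚ`
has no unramified extension and `E/k` is unramified, so `Gal(E/ℚ)` is generated by involutions
outside `Q₈` (`closure_involutions_eq_top`). This forces an element `τ` centralizing `Q₈` with `τ² =
-1` (`exists_sq_eq_and_commute_of_closure_involutions`), and the principle applies with `T = τ`, `S
= iτ`, `R = j`. -/

/-! ### Dimension parity from commuting and anticommuting operators. -/

section LinearAlgebra

variable {F V : Type*} [Field F] [AddCommGroup V] [Module F V]

/-- Taking determinants, `det(T)² = (-1)^dim`, so an odd dimension would make `-1` a square. -/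
theorem even_finrank_of_sq_eq_neg_one [FiniteDimensional F V]
    (hF : ¬ IsSquare (-1 : F)) (T : Module.End F V)
    (hT : ∀ x, T (T x) = -x) : 2 ∣ Module.finrank F V := by
  rw [← even_iff_two_dvd]
  by_contra hodd
  rw [Nat.not_even_iff_odd] at hodd
  apply hF
  have h : T * T = (-1 : F) • LinearMap.id := by
    ext x
    simp [hT]
  have h2 := congrArg LinearMap.det h
  rw [map_mul, LinearMap.det_smul, LinearMap.det_id, hodd.neg_one_pow, mul_one] at h2
  exact ⟨_, h2.symm⟩

/-- The elements of `N` on which `S` acts as the scalar `ε`. -/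
def eigenPart (N : Submodule F V) (S : Module.End F V) (ε : F) : Submodule F V :=
  N ⊓ LinearMap.ker (S - ε • LinearMap.id)

theorem mem_eigenPart {N : Submodule F V} {S : Module.End F V} {ε : F} {x : V} :
    x ∈ eigenPart N S ε ↔ x ∈ N ∧ S x = ε • x := by
  simp [eigenPart, sub_eq_zero]

theorem finrank_eq_add_of_involution [FiniteDimensional F V]
    (h2 : (2 : F) ≠ 0) (N : Submodule F V)
    (S : Module.End F V) (hN : ∀ x ∈ N, S x ∈ N) (hS : ∀ x ∈ N, S (S x) = x) :
    Module.finrank F N =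
      Module.finrank F (eigenPart N S 1) + Module.finrank F (eigenPart N S (-1)) := by
  have hsup : eigenPart N S 1 ⊔ eigenPart N S (-1) = N := by
    apply le_antisymm (sup_le inf_le_left inf_le_left)
    intro x hx
    rw [Submodule.mem_sup]
    refine ⟨(2 : F)⁻¹ • (x + S x), mem_eigenPart.2 ⟨N.smul_mem _ (N.add_mem hx (hN x hx)), ?_⟩,
      (2 : F)⁻¹ • (x - S x), mem_eigenPart.2 ⟨N.smul_mem _ (N.sub_mem hx (hN x hx)), ?_⟩, ?_⟩
    · rw [map_smul, map_add, hS x hx, one_smul, add_comm]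
    · rw [map_smul, map_sub, hS x hx, neg_one_smul, ← smul_neg, neg_sub]
    · rw [← smul_add, add_add_sub_cancel, ← two_smul F x, smul_smul, inv_mul_cancel₀ h2, one_smul]
  have hinf : eigenPart N S 1 ⊓ eigenPart N S (-1) = ⊥ := by
    rw [eq_bot_iff]
    rintro x ⟨hx1, hx2⟩
    have h1 := (mem_eigenPart.1 hx1).2
    rw [(mem_eigenPart.1 hx2).2, one_smul, neg_one_smul, neg_eq_iff_add_eq_zero,
      ← two_smul F x] at h1
    simpa [h2] using h1
  have := Submodule.finrank_sup_add_finrank_inf_eq (eigenPart N S 1) (eigenPart N S (-1))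
  rw [hsup, hinf, finrank_bot] at this
  simpa using this

/-- `R` embeds each eigenspace of `S` into the other, so they have equal dimension. `T` preserves
the `+1` eigenspace, whose dimension is therefore even if `-1` is not a square. -/
theorem finrank_dvd_of_anticommuting [FiniteDimensional F V]
    (h2 : (2 : F) ≠ 0) (N : Submodule F V)
    (T S R : Module.End F V) (hTN : ∀ x ∈ N, T x ∈ N) (hSN : ∀ x ∈ N, S x ∈ N)
    (hRN : ∀ x ∈ N, R x ∈ N) (hT : ∀ x ∈ N, T (T x) = -x) (hS : ∀ x ∈ N, S (S x) = x)
    (hTS : ∀ x ∈ N, S (T x) = T (S x)) (hRS : ∀ x ∈ N, S (R x) = -R (S x))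
    (hR : Function.Injective R) :
    2 ∣ Module.finrank F N ∧ (¬ IsSquare (-1 : F) → 4 ∣ Module.finrank F N) := by
  have hle : ∀ ε : F, Module.finrank F (eigenPart N S ε) ≤
      Module.finrank F (eigenPart N S (-ε)) := by
    intro ε
    have hmap : ∀ x ∈ eigenPart N S ε, R x ∈ eigenPart N S (-ε) := by
      intro x hx
      rw [mem_eigenPart] at hx ⊢
      exact ⟨hRN x hx.1, by rw [hRS x hx.1, hx.2, map_smul, neg_smul]⟩
    refine LinearMap.finrank_le_finrank_of_injective (f := R.restrict hmap) ?_
    intro x y hxy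
    exact Subtype.ext (hR (congrArg Subtype.val hxy))
  have heq : Module.finrank F (eigenPart N S 1) = Module.finrank F (eigenPart N S (-1)) :=
    le_antisymm (hle 1) ((hle (-1)).trans_eq (by rw [neg_neg]))
  have hsum := finrank_eq_add_of_involution h2 N S hSN hS
  refine ⟨by omega, fun hF => ?_⟩
  have hmap : ∀ x ∈ eigenPart N S 1, T x ∈ eigenPart N S 1 := by
    intro x hx
    rw [mem_eigenPart] at hx ⊢
    exact ⟨hTN x hx.1, by rw [hTS x hx.1, hx.2, map_smul]⟩
  have := even_finrank_of_sq_eq_neg_one hF (T.restrict hmap)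
    (fun x => Subtype.ext (hT x (mem_eigenPart.1 x.2).1))
  omega

end LinearAlgebra

/-! ### Index-two overgroups of `Q₈` generated by outside involutions. -/

section QuaternionGroup

open QuaternionGroup

/-- The value at `q` of the endomorphism of the quaternion group with `a 1 ↦ u`, `xa 0 ↦ v`. -/
def quaternionEval (u v : QuaternionGroup 2) : QuaternionGroup 2 → QuaternionGroup 2
  | .a m => u ^ m.val
  | .xa m => v * u ^ m.val

theorem quaternionEval_eq (φ : QuaternionGroup 2 →* QuaternionGroup 2) (q : QuaternionGroup 2) :
    quaternionEval (φ (.a 1)) (φ (.xa 0)) q = φ q := by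
  have h : ∀ q : QuaternionGroup 2, quaternionEval (.a 1) (.xa 0) q = q := by decide
  conv_rhs => rw [← h q]
  cases q <;> simp only [quaternionEval, map_mul, map_pow]

/-- The hypotheses describe an automorphism `φ` with `φ² = 1` through its values on the generators.
The alternative to `φ` being inner is modelled on the swap of `i` and `j`: there `φ(k) = k⁻¹`, and
`φ(q)q = 1` only for `q ∈ ⟨k⟩`. -/
theorem quaternion_involution_cases : ∀ u v : QuaternionGroup 2,
    quaternionEval u v u = .a 1 → quaternionEval u v v = .xa 0 → v * u * v⁻¹ = u⁻¹ →
    u ^ 2 = .a 2 → v ^ 2 = .a 2 →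
    (∃ r : QuaternionGroup 2, u = r * .a 1 * r⁻¹ ∧ v = r * .xa 0 * r⁻¹) ∨
    ∃ x : QuaternionGroup 2, (quaternionEval u v x = x ∨ quaternionEval u v x = x ^ 3) ∧
      ∀ q, quaternionEval u v q * q = 1 → q = 1 ∨ q = x ∨ q = x ^ 2 ∨ q = x ^ 3 := by
  decide

/-- Take an outside involution `σ` not centralizing `Q₈`. If it acts as conjugation by `r`, then `τ
= σr` works. Otherwise every outside involution lies in `⟨σ, x⟩` for a single `x ∈ Q₈`, which is too
small to be all of `G`. -/
theorem exists_sq_eq_and_commute_of_closure_involutions {G : Type*} [Group G]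
    (e : QuaternionGroup 2 →* G) (he : Function.Injective e) (hidx : e.range.index = 2)
    (hgen : Subgroup.closure {σ : G | σ ∉ e.range ∧ σ * σ = 1} = ⊤) :
    ∃ τ : G, τ * τ = e (.a 2) ∧ ∀ q, τ * e q = e q * τ := by
  have hij : e (.a 1) * e (.xa 0) ≠ e (.xa 0) * e (.a 1) := by
    rw [← map_mul, ← map_mul]
    exact fun h => absurd (he h) (by decide)
  obtain ⟨σ, hσ, hσσ, hσc⟩ : ∃ σ : G, σ ∉ e.range ∧ σ * σ = 1 ∧
      ∃ q, σ * e q ≠ e q * σ := by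
    -- If all these involutions centralized `Q₈`, so would the group they generate, and `Q₈` would
    -- be abelian.
    by_contra! hcon
    have hle : Subgroup.closure {σ : G | σ ∉ e.range ∧ σ * σ = 1} ≤
        Subgroup.centralizer (e.range : Set G) := by
      rw [Subgroup.closure_le]
      rintro σ ⟨h1, h2⟩
      rw [SetLike.mem_coe, Subgroup.mem_centralizer_iff]
      rintro _ ⟨q, rfl⟩
      exact (hcon σ h1 h2 q).symm
    rw [hgen] at hle
    have := Subgroup.mem_centralizer_iff.1 (hle (Subgroup.mem_top (e (.xa 0)))) _ ⟨.a 1, rfl⟩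
    exact hij this
  have hinv : σ⁻¹ = σ := inv_eq_of_mul_eq_one_left hσσ
  have hnormal : e.range.Normal := Subgroup.normal_of_index_eq_two hidx
  have hex : ∀ q, ∃ r, e r = σ * e q * σ := by
    intro q
    have := hnormal.conj_mem (e q) ⟨q, rfl⟩ σ
    rw [hinv] at this
    exact this
  choose f hf using hex
  let φ : QuaternionGroup 2 →* QuaternionGroup 2 := MonoidHom.mk' f (by
    intro x y
    apply he
    rw [map_mul, hf, hf, hf, map_mul]
    calc σ * (e x * e y) * σ = σ * e x * 1 * e y * σ := by group
      _ = _ := by rw [← hσσ]; group)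
  have hφ : ∀ q, e (φ q) = σ * e q * σ := hf
  have hφφ : ∀ q, φ (φ q) = q := by
    intro q
    apply he
    rw [hφ, hφ]
    calc σ * (σ * e q * σ) * σ = (σ * σ) * e q * (σ * σ) := by group
      _ = e q := by rw [hσσ]; group
  have hcases := quaternion_involution_cases (φ (.a 1)) (φ (.xa 0))
    (by rw [quaternionEval_eq, hφφ]) (by rw [quaternionEval_eq, hφφ])
    (by rw [← map_inv, ← map_inv, ← map_mul, ← map_mul]; exact congrArg φ (by decide))
    (by
      have h : ∀ q : QuaternionGroup 2, q ^ 2 = .a 2 ∨ q ^ 2 = 1 := by decide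
      refine (h _).resolve_right fun h1 => ?_
      rw [← map_pow] at h1
      have := congrArg φ h1
      rw [hφφ, map_one] at this
      exact absurd this (by decide))
    (by
      have h : ∀ q : QuaternionGroup 2, q ^ 2 = .a 2 ∨ q ^ 2 = 1 := by decide
      refine (h _).resolve_right fun h1 => ?_
      rw [← map_pow] at h1
      have := congrArg φ h1
      rw [hφφ, map_one] at this
      exact absurd this (by decide))
  simp only [quaternionEval_eq] at hcases
  rcases hcases with ⟨r, hr1, hr2⟩ | ⟨x, hφx, hx⟩
  · have hr : ∀ q, φ q = r * q * r⁻¹ := by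
      intro q
      have h := quaternionEval_eq (MulAut.conj r).toMonoidHom q
      have h' := quaternionEval_eq φ q
      simp only [MulEquiv.toMonoidHom_eq_coe, MonoidHom.coe_coe, MulAut.conj_apply] at h
      rw [← hr1, ← hr2] at h
      exact h'.symm.trans h
    have hcomm : ∀ q, σ * e q * σ = e r * e q * (e r)⁻¹ := by
      intro q
      rw [← hφ, hr, map_mul, map_mul, map_inv]
    have hτ : ∀ q, (σ * e r) * e q = e q * (σ * e r) := by
      intro q
      have h := hcomm (r * q * r⁻¹)
      have h1 := hcomm r
      have h2 := hcomm q
      have hσr : σ * e r = e r * σ := by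
        rw [mul_inv_cancel_right] at h1
        rw [← mul_inv_eq_iff_eq_mul, hinv, h1]
      calc σ * e r * e q = e r * (σ * e q * σ) * σ := by
            rw [hσr]
            calc e r * σ * e q = e r * (σ * e q * 1) := by group
              _ = _ := by rw [← hσσ]; group
        _ = e r * (e r * e q * (e r)⁻¹) * σ := by rw [h2]
        _ = e q * (σ * e r) := ?_
      have hcen : ∀ r q : QuaternionGroup 2, (r * r) * q = q * (r * r) := by decide
      have hcen' : e r * e r * e q = e q * (e r * e r) := by
        rw [← map_mul, ← map_mul, hcen r q, map_mul]
      calc e r * (e r * e q * (e r)⁻¹) * σ = (e r * e r * e q) * (e r)⁻¹ * σ := by group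
        _ = e q * (σ * e r) := by rw [hcen', hσr]; group
    -- `σ` fixes `r`, so `(σr)² = r²`. This is `-1` unless `r` is central, which is excluded because
    -- `σ` acts nontrivially.
    refine ⟨σ * e r, ?_, hτ⟩
    have hsq : σ * e r * (σ * e r) = e (r * r) := by
      rw [← mul_assoc, hcomm r, mul_inv_cancel_right, map_mul]
    rw [hsq]
    have h : ∀ r : QuaternionGroup 2, (r * r = .a 2) ∨ ∀ q, r * q * r⁻¹ = q := by decide
    rcases h r with h | h
    · rw [h]
    · exfalso
      obtain ⟨q, hq⟩ := hσc
      apply hq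
      rw [← mul_inv_eq_iff_eq_mul, hinv, ← hφ, hr, h]
  · exfalso
    have hX : ∀ g ∈ Subgroup.zpowers (e x), σ * g * σ ∈ Subgroup.zpowers (e x) := by
      have h1 : σ * e x * σ⁻¹ ∈ Subgroup.zpowers (e x) := by
        rw [hinv, ← hφ]
        rcases hφx with h | h
        · rw [h]; exact Subgroup.mem_zpowers _
        · rw [h, map_pow]; exact Subgroup.pow_mem _ (Subgroup.mem_zpowers _) _
      rintro _ ⟨n, rfl⟩
      have := Subgroup.zpow_mem _ h1 n
      rwa [conj_zpow, hinv] at this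
    -- `K = ⟨x⟩ ∪ σ⟨x⟩`, a subgroup because `σ` normalizes `⟨x⟩`. It meets `Q₈` only in the abelian
    -- group `⟨x⟩`.
    let K : Subgroup G :=
      { carrier := {g | g ∈ Subgroup.zpowers (e x) ∨ σ * g ∈ Subgroup.zpowers (e x)}
        one_mem' := Or.inl (one_mem _)
        mul_mem' := by
          rintro g h (hg | hg) (hh | hh)
          · exact Or.inl (mul_mem hg hh)
          · right
            have := mul_mem (hX g hg) hh
            rwa [show σ * g * σ * (σ * h) = σ * (g * h) by
              calc σ * g * σ * (σ * h) = σ * g * (σ * σ) * h := by group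
                _ = _ := by rw [hσσ]; group] at this
          · right
            rw [← mul_assoc]
            exact mul_mem hg hh
          · left
            have := mul_mem (hX _ hg) hh
            rwa [show σ * (σ * g) * σ * (σ * h) = g * h by
              calc σ * (σ * g) * σ * (σ * h) = (σ * σ) * g * (σ * σ) * h := by group
                _ = _ := by rw [hσσ]; group] at this
        inv_mem' := by
          rintro g (hg | hg)
          · exact Or.inl (inv_mem hg)
          · right
            have := hX _ (inv_mem hg)
            rwa [mul_inv_rev, hinv, show σ * (g⁻¹ * σ) * σ = σ * g⁻¹ by
              calc σ * (g⁻¹ * σ) * σ = σ * g⁻¹ * (σ * σ) := by group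
                _ = _ := by rw [hσσ]; group] at this }
    have hmem : ∀ q, e q ∈ Subgroup.zpowers (e x) → q ∈ Subgroup.zpowers x := by
      rintro q ⟨n, hn⟩
      refine ⟨n, he ?_⟩
      rw [map_zpow]
      exact hn
    have hle : Subgroup.closure {σ : G | σ ∉ e.range ∧ σ * σ = 1} ≤ K := by
      rw [Subgroup.closure_le]
      rintro s ⟨hs, hss⟩
      obtain ⟨q, hq⟩ := (Subgroup.mul_mem_iff_of_index_two hidx (a := σ) (b := s)).2
        (iff_of_false hσ hs)
      right
      rw [← hq]
      -- For `s = σq`, the equation `s² = 1` reads `φ(q)q = 1`.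
      have hs' : s = σ * e q := by rw [hq, ← mul_assoc, hσσ, one_mul]
      have h1 : φ q * q = 1 := by
        apply he
        rw [map_mul, hφ, map_one, ← hss, hs']
        group
      rcases hx q h1 with h | h | h | h
      · rw [h, map_one]; exact one_mem _
      · rw [h]; exact Subgroup.mem_zpowers _
      · rw [h, map_pow]; exact Subgroup.pow_mem _ (Subgroup.mem_zpowers _) _
      · rw [h, map_pow]; exact Subgroup.pow_mem _ (Subgroup.mem_zpowers _) _
    rw [hgen] at hle
    have hall : ∀ q, e q ∈ Subgroup.zpowers (e x) := by
      intro q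
      refine (hle (Subgroup.mem_top (e q))).resolve_right fun h => hσ ?_
      obtain ⟨n, hn⟩ := h
      refine ⟨x ^ n * q⁻¹, ?_⟩
      rw [map_mul, map_zpow, map_inv]
      change e x ^ n = σ * e q at hn
      rw [hn]
      group
    obtain ⟨m, hm⟩ := hall (.a 1)
    obtain ⟨n, hn⟩ := hall (.xa 0)
    apply hij
    rw [← hm, ← hn]
    exact (Commute.refl (e x)).zpow_zpow m n

end QuaternionGroup

/-! ### Decomposition of the norm kernel under the group `32.40`. -/

section Representation

variable {F V : Type*} [Field F] [AddCommGroup V] [Module F V]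

/-- The dimension of a subspace. -/
noncomputable def Submodule.dim (N : Submodule F V) : ℕ := Module.finrank F N

/-- The elements killed by `1 + z + w + z w`. -/
def Group32_40.normKer (ρ : Group32_40 →* Module.End F V) : Submodule F V :=
  LinearMap.ker (1 + ρ ⟨0, 0, 0, 1, 0⟩ + ρ ⟨0, 0, 0, 0, 1⟩ + ρ ⟨0, 0, 0, 1, 1⟩)

/-- The elements fixed by `h` on which `z` acts as `-1`. -/
def quaternionPart {G : Type*} [Monoid G] (ρ : G →* Module.End F V) (z h : G) : Submodule F V :=
  LinearMap.ker (ρ z + 1) ⊓ LinearMap.ker (ρ h - 1)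

theorem mem_quaternionPart {G : Type*} [Monoid G] {ρ : G →* Module.End F V} {z h : G} {x : V} :
    x ∈ quaternionPart ρ z h ↔ ρ z x = -x ∧ ρ h x = x := by
  simp [quaternionPart, sub_eq_zero, add_eq_zero_iff_eq_neg]

/-- The parity principle for operators coming from a group; injectivity of `ρ r` is then automatic.
-/
theorem finrank_dvd_of_relations [FiniteDimensional F V] (h2 : (2 : F) ≠ 0) {G : Type*} [Group G]
    (ρ : G →* Module.End F V) (N : Submodule F V) (t s r : G)
    (hN : ∀ g ∈ ({t, s, r} : Set G), ∀ x ∈ N, ρ g x ∈ N)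
    (ht : ∀ x ∈ N, ρ (t * t) x = -x) (hs : ∀ x ∈ N, ρ (s * s) x = x)
    (hts : ∀ x ∈ N, ρ (s * t) x = ρ (t * s) x)
    (hrs : ∀ x ∈ N, ρ (s * r) x = -ρ (r * s) x) :
    2 ∣ N.dim ∧ (¬ IsSquare (-1 : F) → 4 ∣ N.dim) := by
  refine finrank_dvd_of_anticommuting h2 N (ρ t) (ρ s) (ρ r) (hN t (by simp)) (hN s (by simp))
    (hN r (by simp)) (fun x hx => by simpa using ht x hx) (fun x hx => by simpa using hs x hx)
    (fun x hx => by simpa using hts x hx) (fun x hx => by simpa using hrs x hx) ?_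
  refine Function.LeftInverse.injective (g := ρ r⁻¹) fun x => ?_
  rw [← Module.End.mul_apply, ← map_mul, inv_mul_cancel, map_one, Module.End.one_apply]

/-- The signs of `(z, w)` are `(1, -1)` on `U₁`, `(-1, -1)` on `U₃` and `(-1, 1)` on `Y₁`. The group
relations settle `U₁` and `U₃`; `Y₁` is the sum of the two pieces covered by `hq`. -/
theorem Group32_40.finrank_normKer_dvd [FiniteDimensional F V] (h2 : (2 : F) ≠ 0)
    (ρ : Group32_40 →* Module.End F V)
    (hq : ∀ h ∈ ({⟨0, 0, 1, 0, 0⟩, ⟨0, 0, 1, 1, 0⟩} : Set Group32_40),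
      2 ∣ Submodule.dim (quaternionPart ρ ⟨0, 0, 0, 1, 0⟩ h) ∧
      (¬ IsSquare (-1 : F) → 4 ∣ Submodule.dim (quaternionPart ρ ⟨0, 0, 0, 1, 0⟩ h))) :
    2 ∣ Submodule.dim (normKer ρ) ∧
      (¬ IsSquare (-1 : F) → 4 ∣ Submodule.dim (normKer ρ)) := by
  let z : Group32_40 := ⟨0, 0, 0, 1, 0⟩
  let w : Group32_40 := ⟨0, 0, 0, 0, 1⟩
  let c : Group32_40 := ⟨0, 0, 1, 0, 0⟩
  have hmem : ∀ x, x ∈ normKer ρ ↔ x + ρ z x + ρ w x + ρ (z * w) x = 0 := fun x => by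
    rw [normKer, LinearMap.mem_ker]; rfl
  have hcancel : ∀ x : V, x + x = 0 → x = 0 := fun x hx => by
    rw [← two_smul F x] at hx
    simpa [h2] using hx
  have hρ : ∀ (g h : Group32_40) (x : V), ρ (g * h) x = ρ g (ρ h x) := fun g h x => by
    rw [map_mul, Module.End.mul_apply]
  have hzc : ∀ (g : Group32_40) x, ρ z (ρ g x) = ρ g (ρ z x) := fun g x => by
    rw [← hρ, ← hρ, show z * g = g * z by revert g; decide]
  have hwc : ∀ (g : Group32_40) x, ρ w (ρ g x) = ρ g (ρ w x) := fun g x => by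
    rw [← hρ, ← hρ, show w * g = g * w by revert g; decide]
  have hzz : ∀ x, ρ z (ρ z x) = x := fun x => by
    rw [← hρ, show z * z = 1 by decide, map_one, Module.End.one_apply]
  have hww : ∀ x, ρ w (ρ w x) = x := fun x => by
    rw [← hρ, show w * w = 1 by decide, map_one, Module.End.one_apply]
  have hcc : ∀ x, ρ c (ρ c x) = ρ w x := fun x => by
    rw [← hρ, show c * c = w by decide]
  have hnormKer : ∀ (g : Group32_40), ∀ x ∈ normKer ρ, ρ g x ∈ normKer ρ := fun g x hx => by
    rw [hmem] at hx ⊢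
    rw [hρ, hwc, hzc, hzc, ← hρ z w x, ← map_add, ← map_add, ← map_add, hx, map_zero]
  let U₁ := eigenPart (normKer ρ) (ρ z) 1
  let Y := eigenPart (normKer ρ) (ρ z) (-1)
  let U₃ := eigenPart Y (ρ w) (-1)
  let Y₁ := eigenPart Y (ρ w) 1
  have hU₁ : ∀ x, x ∈ U₁ ↔ ρ z x = x ∧ ρ w x = -x := by
    intro x
    rw [mem_eigenPart, hmem, one_smul, hρ, hzc]
    constructor
    · rintro ⟨h1, h3⟩
      rw [h3] at h1
      exact ⟨h3, (neg_eq_of_add_eq_zero_right (hcancel _ (by rw [← h1]; abel))).symm⟩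
    · rintro ⟨h1, h3⟩
      rw [h1, h3]
      exact ⟨by abel, rfl⟩
  have hY : ∀ x, x ∈ Y ↔ ρ z x = -x := by
    intro x
    rw [mem_eigenPart, hmem, neg_one_smul, hρ, hzc]
    refine ⟨fun h => h.2, fun h => ⟨?_, h⟩⟩
    rw [h, map_neg]
    abel
  have hU₃ : ∀ x, x ∈ U₃ ↔ ρ z x = -x ∧ ρ w x = -x := fun x => by
    rw [mem_eigenPart, hY, neg_one_smul]
  have hY₁ : ∀ x, x ∈ Y₁ ↔ ρ z x = -x ∧ ρ w x = x := fun x => by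
    rw [mem_eigenPart, hY, one_smul]
  have hs1 := finrank_eq_add_of_involution h2 (normKer ρ) (ρ z) (hnormKer z) (fun x _ => hzz x)
  have hs2 := finrank_eq_add_of_involution h2 Y (ρ w)
    (fun x hx => by rw [hY] at hx ⊢; rw [hzc, hx, map_neg]) (fun x _ => hww x)
  -- On `Y₁`, `c² = w` acts as `1`. As `z = -1` there, `c = -1` means that `cz` acts trivially.
  have hs3 := finrank_eq_add_of_involution h2 Y₁ (ρ c)
    (fun x hx => by rw [hY₁] at hx ⊢; rw [hzc, hwc, hx.1, hx.2, map_neg]; exact ⟨rfl, rfl⟩)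
    (fun x hx => by rw [hcc]; exact ((hY₁ x).1 hx).2)
  have hW₁ : eigenPart Y₁ (ρ c) 1 = quaternionPart ρ z c := by
    ext x
    rw [mem_eigenPart, hY₁, mem_quaternionPart, one_smul]
    refine ⟨fun h => ⟨h.1.1, h.2⟩, fun h => ⟨⟨h.1, ?_⟩, h.2⟩⟩
    rw [← hcc, h.2, h.2]
  have hW₂ : eigenPart Y₁ (ρ c) (-1) = quaternionPart ρ z ⟨0, 0, 1, 1, 0⟩ := by
    ext x
    rw [mem_eigenPart, hY₁, mem_quaternionPart, neg_one_smul,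
      show (⟨0, 0, 1, 1, 0⟩ : Group32_40) = c * z by decide, hρ]
    constructor
    · rintro ⟨⟨h1, h3⟩, h4⟩
      rw [h1, map_neg, h4, neg_neg]
      exact ⟨rfl, rfl⟩
    · rintro ⟨h1, h3⟩
      rw [h1, map_neg, neg_eq_iff_eq_neg] at h3
      refine ⟨⟨h1, ?_⟩, h3⟩
      rw [← hcc, h3, map_neg, h3, neg_neg]
  -- `T, S, R = b, a, c`: here `b² = zw = -1` and `a² = z = 1`, while `[a,b] = z = 1` and `[a,c] = w
  -- = -1`.
  have hd1 : 2 ∣ U₁.dim ∧ (¬ IsSquare (-1 : F) → 4 ∣ U₁.dim) := by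
    refine finrank_dvd_of_relations h2 ρ U₁ ⟨0, 1, 0, 0, 0⟩ ⟨1, 0, 0, 0, 0⟩ ⟨0, 0, 1, 0, 0⟩
      (fun g _ x hx => ?_) (fun x hx => ?_) (fun x hx => ?_) (fun x hx => ?_) (fun x hx => ?_)
    · rw [hU₁] at hx ⊢
      rw [hzc, hwc, hx.1, hx.2, map_neg]
      exact ⟨rfl, rfl⟩
    all_goals obtain ⟨hz, hw⟩ := (hU₁ x).1 hx
    · rw [show (⟨0, 1, 0, 0, 0⟩ * ⟨0, 1, 0, 0, 0⟩ : Group32_40) = w * z by decide, hρ, hz, hw]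
    · rw [show (⟨1, 0, 0, 0, 0⟩ * ⟨1, 0, 0, 0, 0⟩ : Group32_40) = z by decide, hz]
    · rw [show (⟨1, 0, 0, 0, 0⟩ * ⟨0, 1, 0, 0, 0⟩ : Group32_40) =
        ⟨0, 1, 0, 0, 0⟩ * ⟨1, 0, 0, 0, 0⟩ * z by decide, hρ, hz]
    · rw [show (⟨1, 0, 0, 0, 0⟩ * ⟨0, 0, 1, 0, 0⟩ : Group32_40) =
        ⟨0, 0, 1, 0, 0⟩ * ⟨1, 0, 0, 0, 0⟩ * w by decide, hρ, hw, map_neg]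
  -- `T, S, R = bc, b, a`: here `(bc)² = z = -1` and `b² = zw = 1`, while `b` commutes with `bc` and
  -- `[a,b] = z = -1`.
  have hd3 : 2 ∣ U₃.dim ∧ (¬ IsSquare (-1 : F) → 4 ∣ U₃.dim) := by
    refine finrank_dvd_of_relations h2 ρ U₃ ⟨0, 1, 1, 0, 0⟩ ⟨0, 1, 0, 0, 0⟩ ⟨1, 0, 0, 0, 0⟩
      (fun g _ x hx => ?_) (fun x hx => ?_) (fun x hx => ?_) (fun x hx => ?_) (fun x hx => ?_)
    · rw [hU₃] at hx ⊢
      rw [hzc, hwc, hx.1, hx.2, map_neg]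
      exact ⟨rfl, rfl⟩
    all_goals obtain ⟨hz, hw⟩ := (hU₃ x).1 hx
    · rw [show (⟨0, 1, 1, 0, 0⟩ * ⟨0, 1, 1, 0, 0⟩ : Group32_40) = z by decide, hz]
    · rw [show (⟨0, 1, 0, 0, 0⟩ * ⟨0, 1, 0, 0, 0⟩ : Group32_40) = w * z by decide, hρ, hz, map_neg,
        hw, neg_neg]
    · rw [show (⟨0, 1, 0, 0, 0⟩ * ⟨0, 1, 1, 0, 0⟩ : Group32_40) =
        ⟨0, 1, 1, 0, 0⟩ * ⟨0, 1, 0, 0, 0⟩ by decide]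
    · rw [show (⟨0, 1, 0, 0, 0⟩ * ⟨1, 0, 0, 0, 0⟩ : Group32_40) =
        ⟨1, 0, 0, 0, 0⟩ * ⟨0, 1, 0, 0, 0⟩ * z by decide, hρ, hz, map_neg]
  have hq1 := hq c (by simp [c])
  have hq2 := hq ⟨0, 0, 1, 1, 0⟩ (by simp)
  rw [hW₁, hW₂] at hs3
  change Y₁.dim = Submodule.dim _ + Submodule.dim _ at hs3
  change 2 ∣ Submodule.dim (quaternionPart ρ z _) ∧
    (_ → 4 ∣ Submodule.dim (quaternionPart ρ z _)) at hq1 hq2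
  change (normKer ρ).dim = U₁.dim + Y.dim at hs1
  change Y.dim = Y₁.dim + U₃.dim at hs2
  refine ⟨?_, fun hF => ?_⟩
  · have := hd1.1; have := hd3.1; have := hq1.1; have := hq2.1
    omega
  · have := hd1.2 hF; have := hd3.2 hF; have := hq1.2 hF; have := hq2.2 hF
    omega

end Representation

/-! ### The rank of a finite abelian `p`-group as the dimension of its `p`-torsion. -/

section Rank

variable (A B C : Type*) [CommGroup A] [CommGroup B] [CommGroup C] (p : ℕ) 

/-- The elements `x` with `x ^ p = 1`, as an additive group. -/
abbrev PTorsion : Type _ := Additive (powMonoidHom p : A →* A).ker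

noncomputable instance : Module (ZMod p) (PTorsion A p) :=
  AddCommGroup.zmodModule (fun x => by
    apply Additive.toMul.injective
    apply Subtype.ext
    exact x.toMul.2)

variable {A B C}

/-- The map on `p`-torsion induced by a homomorphism. -/
noncomputable def PTorsion.map (f : A →* B) : PTorsion A p →ₗ[ZMod p] PTorsion B p :=
  AddMonoidHom.toZModLinearMap p (MonoidHom.toAdditive
    ((f.comp (powMonoidHom p : A →* A).ker.subtype).codRestrict (powMonoidHom p : B →* B).ker
      (fun x => by
        have h : (x : A) ^ p = 1 := x.2
        change f x ^ p = 1
        rw [← map_pow, h, map_one])))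

variable {p} in
theorem PTorsion.ext {x y : PTorsion A p} (h : (x.toMul : A) = y.toMul) : x = y :=
  Additive.toMul.injective (Subtype.ext h)

theorem zmod_two_ne_zero {p : ℕ} [Fact p.Prime] (hp : p ≠ 2) : (2 : ZMod p) ≠ 0 := by
  intro h
  have h2 : ((2 : ℕ) : ZMod p) = 0 := by exact_mod_cast h
  rw [ZMod.natCast_eq_zero_iff] at h2
  exact hp ((Nat.prime_dvd_prime_iff_eq Fact.out Nat.prime_two).1 h2)

theorem closure_eq_top_iff_span_eq_top {A : Type*} [CommGroup A] (p : ℕ) [NeZero p]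
    [Module (ZMod p) (Additive A)] (S : Set A) :
    Subgroup.closure S = ⊤ ↔ Submodule.span (ZMod p) (Additive.toMul ⁻¹' S) = ⊤ := by
  constructor
  · refine fun h => eq_top_iff.2 fun x hx0 => ?_
    clear hx0
    obtain ⟨x, rfl⟩ := Additive.ofMul.surjective x
    have hx : x ∈ Subgroup.closure S := h ▸ Subgroup.mem_top x
    induction hx using Subgroup.closure_induction with
    | mem y hy => exact Submodule.subset_span hy
    | one => exact zero_mem _
    | mul y z _ _ hy hz => exact add_mem hy hz
    | inv y _ hy => exact neg_mem hy
  · refine fun h => eq_top_iff.2 fun x hx0 => ?_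
    clear hx0
    obtain ⟨x, rfl⟩ := Additive.toMul.surjective x
    have hx : x ∈ Submodule.span (ZMod p) (Additive.toMul ⁻¹' S) := h ▸ Submodule.mem_top
    induction hx using Submodule.span_induction with
    | mem y hy => exact Subgroup.subset_closure hy
    | zero => exact one_mem _
    | add y z _ _ hy hz => exact mul_mem hy hz
    | smul c y _ hy =>
      rw [← ZMod.natCast_zmod_val c, Nat.cast_smul_eq_nsmul, toMul_nsmul]
      exact pow_mem hy _

theorem rank_eq_finrank_of_zmod_module {A : Type*} [CommGroup A] [Finite A] (p : ℕ)
    [Fact p.Prime] [Module (ZMod p) (Additive A)] :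
    Group.rank A = Module.finrank (ZMod p) (Additive A) := by
  classical
  have : Module.Finite (ZMod p) (Additive A) := Module.Finite.of_finite
  apply le_antisymm
  · let b := Module.finBasis (ZMod p) (Additive A)
    have hb : Subgroup.closure ((Finset.univ.image (fun i => (b i).toMul) : Finset A) : Set A) =
        ⊤ := by
      rw [closure_eq_top_iff_span_eq_top p, eq_top_iff, ← b.span_eq]
      apply Submodule.span_mono
      rintro _ ⟨i, rfl⟩
      simp
    exact (Group.rank_le hb).trans (Finset.card_image_le.trans (by simp))
  · obtain ⟨S, hS, hS'⟩ := Group.rank_spec A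
    rw [closure_eq_top_iff_span_eq_top p] at hS'
    have h := finrank_span_finset_le_card (R := ZMod p) (S.map Additive.ofMul.toEmbedding)
    rw [Finset.card_map, hS] at h
    have h' : ((S.map Additive.ofMul.toEmbedding : Finset (Additive A)) : Set (Additive A)) =
        Additive.toMul ⁻¹' S := by
      ext x
      simp
    rwa [h', Set.finrank, hS', finrank_top] at h

theorem natCard_eq_pow_rank_of_zmod_module {A : Type*} [CommGroup A] [Finite A] (p : ℕ)
    [Fact p.Prime] [Module (ZMod p) (Additive A)] : Nat.card A = p ^ Group.rank A := by
  have : Module.Finite (ZMod p) (Additive A) := Module.Finite.of_finite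
  rw [rank_eq_finrank_of_zmod_module p, ← Nat.card_congr Additive.ofMul.symm,
    Module.natCard_eq_pow_finrank (K := ZMod p), Nat.card_zmod]

/-- `A/A^p` and `A[p]` have the same order, being the cokernel and kernel of the `p`-th power map.
Passing to `A/A^p` keeps the rank: if `M` is generated by lifts of generators, then `A = M·A^(p^n)`
for all `n`, and `A^(p^n)` is eventually trivial. -/
theorem rank_eq_finrank_pTorsion {A : Type*} [CommGroup A] [Finite A] (p : ℕ)
    [Fact p.Prime] (hA : IsPGroup p A) :
    Group.rank A = Module.finrank (ZMod p) (PTorsion A p) := by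
  classical
  let R : Subgroup A := (powMonoidHom p : A →* A).range
  let : Module (ZMod p) (Additive (A ⧸ R)) := AddCommGroup.zmodModule (fun x => by
    apply Additive.toMul.injective
    obtain ⟨y, hy⟩ := QuotientGroup.mk_surjective x.toMul
    rw [toMul_nsmul, ← hy, ← QuotientGroup.mk_pow, toMul_zero, QuotientGroup.eq_one_iff]
    exact ⟨y, rfl⟩)
  have hrank : Group.rank A = Group.rank (A ⧸ R) := by
    apply le_antisymm
    · obtain ⟨S, hS, hS'⟩ := Group.rank_spec (A ⧸ R)
      rw [← hS]
      let M := Subgroup.closure ((S.image Quotient.out : Finset A) : Set A)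
      have hMR : ∀ x : A, ∃ m ∈ M, ∃ y : A, x = m * y ^ p := by
        intro x
        have hle : Subgroup.closure (S : Set (A ⧸ R)) ≤ M.map (QuotientGroup.mk' R) := by
          rw [Subgroup.closure_le]
          intro s hs
          exact ⟨s.out, Subgroup.subset_closure (Finset.mem_image_of_mem _ hs), s.out_eq⟩
        rw [hS'] at hle
        obtain ⟨m, hm, hmx⟩ := hle (Subgroup.mem_top (x : A ⧸ R))
        obtain ⟨y, hy⟩ := QuotientGroup.eq.1 hmx
        refine ⟨m, hm, y, ?_⟩
        rw [show y ^ p = m⁻¹ * x from hy, mul_inv_cancel_left]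
      have hMn : ∀ (n : ℕ) (x : A), ∃ m ∈ M, ∃ y : A, x = m * y ^ p ^ n := by
        intro n
        induction n with
        | zero => exact fun x => ⟨1, one_mem _, x, by simp⟩
        | succ n ih =>
          intro x
          obtain ⟨m, hm, y, rfl⟩ := ih x
          obtain ⟨m', hm', y', rfl⟩ := hMR y
          refine ⟨m * m' ^ p ^ n, mul_mem hm (pow_mem hm' _), y', ?_⟩
          rw [mul_pow, ← pow_mul, ← pow_succ', mul_assoc]
      obtain ⟨n, hn⟩ := (IsPGroup.iff_card).1 hA
      have hM : M = ⊤ := by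
        rw [eq_top_iff]
        intro x _
        obtain ⟨m, hm, y, rfl⟩ := hMn n x
        rwa [← hn, pow_card_eq_one', mul_one]
      exact (Group.rank_le hM).trans Finset.card_image_le
    · exact Group.rank_le_of_surjective _ (QuotientGroup.mk'_surjective R)
  have hcard : Nat.card (A ⧸ R) = Nat.card (powMonoidHom p : A →* A).ker := by
    have h1 := R.index_mul_card
    have h2 := (powMonoidHom p : A →* A).ker.card_mul_index
    rw [Subgroup.index_ker, ← h1] at h2
    exact (Nat.eq_of_mul_eq_mul_right Nat.card_pos h2).symm
  rw [hrank, ← rank_eq_finrank_of_zmod_module p]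
  rw [natCard_eq_pow_rank_of_zmod_module p, natCard_eq_pow_rank_of_zmod_module p] at hcard
  exact Nat.pow_right_injective (Fact.out : p.Prime).two_le hcard

end Rank

/-! ### Functoriality of class groups and the Galois action on their torsion. -/

theorem smul_toRingHom_injective {B : Type*} [Semiring B] (G : Type*) [Group G]
    [MulSemiringAction G B] (g : G) : Function.Injective (MulSemiringAction.toRingHom G B g) :=
  MulAction.injective g

section ClassGroupMap

variable {A B C : Type*} [CommRing A] [IsDedekindDomain A] [CommRing B] [IsDedekindDomain B]
  [CommRing C] [IsDedekindDomain C]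

/-- The homomorphism of class groups given by the extension of ideals along an injective ring
homomorphism of Dedekind domains. -/
noncomputable def ClassGroup.extendAlong (f : A →+* B) (hf : Function.Injective f) :
    ClassGroup A →* ClassGroup B :=
  letI := f.toAlgebra
  haveI : FaithfulSMul A B := (faithfulSMul_iff_algebraMap_injective A B).2 hf
  ClassGroup.extendedHom A B

theorem ClassGroup.extendAlong_mk0 (f : A →+* B) (hf : Function.Injective f) (I : (Ideal A)⁰)
    (J : (Ideal B)⁰) (hJ : (J : Ideal B) = (I : Ideal A).map f) :
    ClassGroup.extendAlong f hf (ClassGroup.mk0 I) = ClassGroup.mk0 J := by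
  let := f.toAlgebra
  have : FaithfulSMul A B := (faithfulSMul_iff_algebraMap_injective A B).2 hf
  exact (ClassGroup.extendedHom_mk0 A B I).trans (congrArg _ (Subtype.ext hJ.symm))

theorem map_mem_nonZeroDivisors_of_injective (f : A →+* B) (hf : Function.Injective f)
    (I : (Ideal A)⁰) : (I : Ideal A).map f ∈ (Ideal B)⁰ := by
  rw [mem_nonZeroDivisors_iff_ne_zero]
  exact fun h => mem_nonZeroDivisors_iff_ne_zero.1 I.2 ((Ideal.map_eq_bot_iff_of_injective hf).1 h)

theorem ClassGroup.extendAlong_extendAlong (f : A →+* B) (hf : Function.Injective f) (g : B →+* C)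
    (hg : Function.Injective g) (h : A →+* C) (hh : Function.Injective h)
    (hfg : ∀ x, g (f x) = h x) (x : ClassGroup A) :
    ClassGroup.extendAlong g hg (ClassGroup.extendAlong f hf x) =
      ClassGroup.extendAlong h hh x := by
  obtain ⟨I, rfl⟩ := ClassGroup.mk0_surjective x
  rw [ClassGroup.extendAlong_mk0 f hf I ⟨_, map_mem_nonZeroDivisors_of_injective f hf I⟩ rfl]
  rw [ClassGroup.extendAlong_mk0 h hh I ⟨_, map_mem_nonZeroDivisors_of_injective h hh I⟩ rfl]
  refine ClassGroup.extendAlong_mk0 _ _ _ _ ?_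
  rw [Ideal.map_map, show g.comp f = h from RingHom.ext hfg]

variable (G : Type*) [Group G] [MulSemiringAction G B]

variable (B) in
/-- The action on the class group induced by an action on a Dedekind domain. -/
noncomputable def classGroupAction (g : G) : ClassGroup B →* ClassGroup B :=
  ClassGroup.extendAlong (MulSemiringAction.toRingHom G B g) (smul_toRingHom_injective G g)

theorem classGroupAction_one (x : ClassGroup B) : classGroupAction B G 1 x = x := by
  obtain ⟨I, rfl⟩ := ClassGroup.mk0_surjective x
  refine ClassGroup.extendAlong_mk0 _ _ _ _ ?_
  have : MulSemiringAction.toRingHom G B 1 = RingHom.id B := by ext x; simp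
  rw [this, Ideal.map_id]

variable {G} in
theorem classGroupAction_mul (g h : G) (x : ClassGroup B) :
    classGroupAction B G (g * h) x = classGroupAction B G g (classGroupAction B G h x) :=
  (ClassGroup.extendAlong_extendAlong _ (smul_toRingHom_injective G h) _
    (smul_toRingHom_injective G g) _ (smul_toRingHom_injective G (g * h))
    (fun x => (mul_smul g h x).symm) x).symm

variable (B) in
/-- The action on the `p`-torsion of the class group. -/
noncomputable def pTorsionAction (p : ℕ) :
    G →* Module.End (ZMod p) (PTorsion (ClassGroup B) p) where
  toFun g := PTorsion.map p (classGroupAction B G g)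
  map_one' := LinearMap.ext fun _ => PTorsion.ext (classGroupAction_one G _)
  map_mul' g h := LinearMap.ext fun _ => PTorsion.ext (classGroupAction_mul g h _)

end ClassGroupMap

/-! ### Norm and extension of ideal classes. -/

section NormExtension

variable (F E : Type*) [Field F] [NumberField F] [Field E] [NumberField E] [Algebra F E]

/-- The homomorphism `Cl(F) → Cl(E)` given by the extension of ideals. -/
noncomputable def classGroupExtend : ClassGroup (𝓞 F) →* ClassGroup (𝓞 E) :=
  ClassGroup.extendAlong (algebraMap (𝓞 F) (𝓞 E)) (FaithfulSMul.algebraMap_injective _ _)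

variable {F E} in
theorem relNorm_eq_top_iff {I : Ideal (𝓞 E)} : Ideal.relNorm (𝓞 F) I = ⊤ ↔ I = ⊤ := by
  refine ⟨fun h => ?_, fun h => by rw [h, Ideal.relNorm_top]⟩
  have := Ideal.relNorm_le_comap (𝓞 F) I
  rw [h, top_le_iff, Ideal.comap_eq_top_iff] at this
  exact this

variable {F E} in
theorem eq_of_le_of_relNorm_eq {I J : Ideal (𝓞 E)} (hI : I ≠ ⊥) (hIJ : I ≤ J)
    (h : Ideal.relNorm (𝓞 F) I = Ideal.relNorm (𝓞 F) J) : I = J := by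
  obtain ⟨M, rfl⟩ := Ideal.dvd_iff_le.2 hIJ
  have hJ : Ideal.relNorm (𝓞 F) J ≠ 0 := by
    rw [← h, Ideal.zero_eq_bot, Ne, Ideal.relNorm_eq_bot_iff]
    exact hI
  rw [map_mul] at h
  have hM := mul_left_cancel₀ hJ (h.trans (mul_one _).symm)
  rw [Ideal.one_eq_top, relNorm_eq_top_iff] at hM
  rw [hM, Ideal.mul_top]

variable (G : Type*) [Group G] [Fintype G] [MulSemiringAction G E] [IsGaloisGroup G F E]

variable {F} in
theorem algebraMap_intNorm_eq_prod_smul (x : 𝓞 E) :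
    algebraMap (𝓞 F) (𝓞 E) (Algebra.intNorm (𝓞 F) (𝓞 E) x) = ∏ g : G, g • x := by
  have := IsGaloisGroup.isGalois G F E
  apply FaithfulSMul.algebraMap_injective (𝓞 E) E
  rw [← IsScalarTower.algebraMap_apply, IsScalarTower.algebraMap_apply (𝓞 F) F E,
    Algebra.algebraMap_intNorm (L := E), Algebra.norm_eq_prod_automorphisms, map_prod,
    ← (IsGaloisGroup.mulEquivAlgEquiv G F E).toEquiv.prod_comp]
  rfl

/-- The inclusion `≤` holds on generators, since the norm of an element is the product of its
conjugates. Both sides have relative norm `N(I)^[E:F]`, which forces equality. -/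
theorem map_relNorm_eq_prod (I : Ideal (𝓞 E)) (hI : I ≠ ⊥) :
    (Ideal.relNorm (𝓞 F) I).map (algebraMap (𝓞 F) (𝓞 E)) =
      ∏ g : G, I.map (MulSemiringAction.toRingHom G (𝓞 E) g) := by
  apply eq_of_le_of_relNorm_eq (F := F)
  · rw [Ne, Ideal.map_eq_bot_iff_of_injective (FaithfulSMul.algebraMap_injective _ _),
      Ideal.relNorm_eq_bot_iff]
    exact hI
  · rw [Ideal.map_relNorm, Ideal.span_le]
    rintro _ ⟨x, hx, rfl⟩
    rw [Function.comp_apply, algebraMap_intNorm_eq_prod_smul E G]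
    exact Ideal.prod_mem_prod fun g _ => Ideal.mem_map_of_mem _ hx
  · have h : ∀ g : G, Ideal.relNorm (𝓞 F) (I.map (MulSemiringAction.toRingHom G (𝓞 E) g)) =
        Ideal.relNorm (𝓞 F) I := fun g => Ideal.relNorm_smul (𝓞 F) g I
    rw [Ideal.relNorm_algebraMap, map_prod, Finset.prod_congr rfl (fun g _ => h g),
      Finset.prod_const, Finset.card_univ, ← Nat.card_eq_fintype_card,
      IsGaloisGroup.card_eq_finrank' G (𝓞 F) (𝓞 E)]

theorem classGroupNorm_extend (x : ClassGroup (𝓞 F)) :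
    classGroupNorm F E (classGroupExtend F E x) = x ^ Module.finrank (𝓞 F) (𝓞 E) := by
  obtain ⟨I, rfl⟩ := ClassGroup.mk0_surjective x
  rw [classGroupExtend, ClassGroup.extendAlong_mk0 _ _ I
    ⟨_, map_mem_nonZeroDivisors_of_injective _ (FaithfulSMul.algebraMap_injective _ _) I⟩ rfl,
    classGroupNorm_mk0, ← map_pow]
  congr 1
  apply Subtype.ext
  exact Ideal.relNorm_algebraMap (𝓞 E) (I : Ideal (𝓞 F))

theorem classGroupExtend_norm (x : ClassGroup (𝓞 E)) :
    classGroupExtend F E (classGroupNorm F E x) = ∏ g : G, classGroupAction (𝓞 E) G g x := by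
  obtain ⟨I, rfl⟩ := ClassGroup.mk0_surjective x
  let J : G → (Ideal (𝓞 E))⁰ := fun g =>
    ⟨_, map_mem_nonZeroDivisors_of_injective _ (smul_toRingHom_injective G g) I⟩
  have hJ : ∀ g, classGroupAction (𝓞 E) G g (ClassGroup.mk0 I) = ClassGroup.mk0 (J g) :=
    fun g => ClassGroup.extendAlong_mk0 _ _ _ _ rfl
  simp only [hJ]
  rw [classGroupNorm_mk0, ← map_prod]
  refine ClassGroup.extendAlong_mk0 _ _ _ _ ?_
  rw [Submonoid.coe_finsetProd]
  exact (map_relNorm_eq_prod F E G I (mem_nonZeroDivisors_iff_ne_zero.1 I.2)).symm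

end NormExtension

/-! ### Descent of `p`-torsion when `p` is prime to the group order. -/

section Torsion

theorem ClassGroup.extendAlong_congr {A B : Type*} [CommRing A] [IsDedekindDomain A] [CommRing B]
    [IsDedekindDomain B] {f g : A →+* B} (hf : Function.Injective f) (hg : Function.Injective g)
    (h : ∀ x, f x = g x) (x : ClassGroup A) :
    ClassGroup.extendAlong f hf x = ClassGroup.extendAlong g hg x := by
  obtain rfl : f = g := RingHom.ext h
  rfl

theorem eq_one_of_pow_eq_one_of_coprime {A : Type*} [Group A] {p n : ℕ} (h : n.Coprime p) {x : A}
    (hn : x ^ n = 1) (hp : x ^ p = 1) : x = 1 := by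
  rw [← orderOf_dvd_iff_pow_eq_one] at hn hp
  exact orderOf_eq_one_iff.1 (Nat.dvd_one.1 (h ▸ Nat.dvd_gcd hn hp))

theorem PTorsion.pow_eq_one {A : Type*} [CommGroup A] {p : ℕ} (x : PTorsion A p) :
    (x.toMul : A) ^ p = 1 := x.toMul.2

theorem PTorsion.map_injective {A B : Type*} [CommGroup A] [CommGroup B] {p : ℕ} {f : A →* B}
    (hf : ∀ x, x ^ p = 1 → f x = 1 → x = 1) : Function.Injective (PTorsion.map p f) := by
  rw [← LinearMap.ker_eq_bot, LinearMap.ker_eq_bot']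
  intro x hx
  apply PTorsion.ext
  exact hf _ x.pow_eq_one (congrArg (fun y : PTorsion B p => (y.toMul : B)) hx)

/-- The element of the `p`-torsion given by an element with trivial `p`-th power. -/
def PTorsion.mk {A : Type*} [CommGroup A] {p : ℕ} (x : A) (hx : x ^ p = 1) : PTorsion A p :=
  Additive.ofMul ⟨x, hx⟩

theorem PTorsion.sum_val {A ι : Type*} [CommGroup A] {p : ℕ} (s : Finset ι)
    (x : ι → PTorsion A p) :
    ((∑ i ∈ s, x i).toMul : A) = ∏ i ∈ s, ((x i).toMul : A) := by
  rw [toMul_sum, Subgroup.val_finsetProd]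

variable (F E : Type*) [Field F] [NumberField F] [Field E] [NumberField E] [Algebra F E]
  (G : Type*) [Group G] [Fintype G] [MulSemiringAction G E] [IsGaloisGroup G F E] (p : ℕ)

/-- Extension followed by norm is the power map with exponent `|G|`, prime to `p`. -/
theorem classGroupExtend_injective_on_torsion (hp : (Nat.card G).Coprime p)
    (x : ClassGroup (𝓞 F)) (hx : x ^ p = 1) (h : classGroupExtend F E x = 1) : x = 1 := by
  refine eq_one_of_pow_eq_one_of_coprime hp ?_ hx
  rw [IsGaloisGroup.card_eq_finrank' G (𝓞 F) (𝓞 E), ← classGroupNorm_extend, h, map_one]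

/-- Norm followed by extension is `∑ g`, and extension is injective on `p`-torsion, so on `Cl(E)[p]`
the kernels of the norm and of `∑ g` coincide. -/
theorem rank_relClassGroupPart [Fact p.Prime] (hp : (Nat.card G).Coprime p) :
    Group.rank (relClassGroupPart F E p) =
      (LinearMap.ker (∑ g : G, pTorsionAction (𝓞 E) G p g)).dim := by
  have hP : IsPGroup p (relClassGroupPart F E p) := CommGroup.primaryComponent.isPGroup
  rw [rank_eq_finrank_pTorsion p hP]
  let f : relClassGroupPart F E p →* ClassGroup (𝓞 E) :=
    (relClassGroup F E).subtype.comp (relClassGroupPart F E p).subtype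
  have hf : Function.Injective (PTorsion.map p f) :=
    PTorsion.map_injective fun x _ hx => Subtype.ext (Subtype.ext hx)
  rw [← LinearMap.finrank_range_of_inj hf]
  have hmem : ∀ x : PTorsion (ClassGroup (𝓞 E)) p,
      x ∈ LinearMap.ker (∑ g : G, pTorsionAction (𝓞 E) G p g) ↔
        classGroupNorm F E (x.toMul : ClassGroup (𝓞 E)) = 1 := by
    intro x
    have h : (((∑ g : G, pTorsionAction (𝓞 E) G p g) x).toMul : ClassGroup (𝓞 E)) =
        classGroupExtend F E (classGroupNorm F E (x.toMul : ClassGroup (𝓞 E))) := by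
      rw [LinearMap.sum_apply, PTorsion.sum_val, classGroupExtend_norm F E G]
      rfl
    rw [LinearMap.mem_ker]
    constructor
    · intro hx
      apply classGroupExtend_injective_on_torsion F E G p hp
      · rw [← map_pow, x.pow_eq_one, map_one]
      · rw [← h, hx]
        rfl
    · intro hx
      apply PTorsion.ext
      rw [h, hx, map_one]
      rfl
  have : LinearMap.range (PTorsion.map p f) =
      LinearMap.ker (∑ g : G, pTorsionAction (𝓞 E) G p g) := by
    ext x
    rw [hmem]
    constructor
    · rintro ⟨y, rfl⟩
      exact (y.toMul : relClassGroupPart F E p).1.2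
    · intro hx
      let y : relClassGroup F E := ⟨(x.toMul : ClassGroup (𝓞 E)), hx⟩
      have hyp : y ^ p = 1 := Subtype.ext x.pow_eq_one
      let y' : relClassGroupPart F E p := ⟨y, 1, by rw [pow_one]; exact hyp⟩
      exact ⟨PTorsion.mk y' (Subtype.ext hyp), PTorsion.ext rfl⟩
  rw [← this]
  rfl

theorem rank_relClassGroupPart_of_subgroup [Fact p.Prime] {Γ : Type*} [Group Γ]
    [MulSemiringAction Γ E] (H : Subgroup Γ) [Fintype H] [IsGaloisGroup H F E]
    (hp : (Nat.card H).Coprime p) :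
    Group.rank (relClassGroupPart F E p) =
      (LinearMap.ker (∑ g : H, pTorsionAction (𝓞 E) Γ p g)).dim :=
  rank_relClassGroupPart F E H p hp

/-- Extension of ideals identifies `Cl(F)[p]` with the `h`-fixed part of `Cl(E)[p]`, compatibly with
`z'` and `z`. The element `1` on the right makes the fixedness condition there vacuous. -/
theorem dim_quaternionPart_eq [Fact p.Prime] {Γ : Type*} [Group Γ] [Finite Γ]
    [MulSemiringAction Γ E] (h : Γ) [IsGaloisGroup (Subgroup.zpowers h) F E]
    (hp : (Nat.card (Subgroup.zpowers h)).Coprime p) {G' : Type*} [Group G']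
    [MulSemiringAction G' F] (z : Γ) (z' : G')
    (hz : ∀ x : 𝓞 F, z • algebraMap (𝓞 F) (𝓞 E) x = algebraMap (𝓞 F) (𝓞 E) (z' • x)) :
    (quaternionPart (pTorsionAction (𝓞 E) Γ p) z h).dim =
      (quaternionPart (pTorsionAction (𝓞 F) G' p) z' 1).dim := by
  have := Fintype.ofFinite (Subgroup.zpowers h)
  let J := PTorsion.map p (classGroupExtend F E)
  have hJ : Function.Injective J :=
    PTorsion.map_injective (classGroupExtend_injective_on_torsion F E (Subgroup.zpowers h) p hp)
  have hcomm : ∀ (g : Γ) (g' : G')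
      (_ : ∀ x : 𝓞 F, g • algebraMap (𝓞 F) (𝓞 E) x = algebraMap (𝓞 F) (𝓞 E) (g' • x))
      (x : PTorsion (ClassGroup (𝓞 F)) p),
      pTorsionAction (𝓞 E) Γ p g (J x) = J (pTorsionAction (𝓞 F) G' p g' x) := by
    intro g g' hg x
    apply PTorsion.ext
    have hinj : Function.Injective ((algebraMap (𝓞 F) (𝓞 E)).comp
        (MulSemiringAction.toRingHom G' (𝓞 F) g')) :=
      (FaithfulSMul.algebraMap_injective _ _).comp (smul_toRingHom_injective G' g')
    exact (ClassGroup.extendAlong_extendAlong _ (FaithfulSMul.algebraMap_injective _ _) _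
        (smul_toRingHom_injective Γ g) _ hinj hg _).trans
      (ClassGroup.extendAlong_extendAlong _ (smul_toRingHom_injective G' g') _
        (FaithfulSMul.algebraMap_injective _ _) _ hinj (fun _ => rfl) _).symm
  have hfix : ∀ x : 𝓞 F, h • algebraMap (𝓞 F) (𝓞 E) x =
      algebraMap (𝓞 F) (𝓞 E) ((1 : G') • x) := by
    intro x
    rw [one_smul]
    have hcom : SMulCommClass (Subgroup.zpowers h) F E := IsGaloisGroup.commutes
    exact NumberField.RingOfIntegers.ext
      (smul_algebraMap (⟨h, Subgroup.mem_zpowers h⟩ : Subgroup.zpowers h) (x : F))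
  have hmap : (quaternionPart (pTorsionAction (𝓞 F) G' p) z' 1).map J =
      quaternionPart (pTorsionAction (𝓞 E) Γ p) z h := by
    ext x
    rw [Submodule.mem_map, mem_quaternionPart]
    constructor
    · rintro ⟨y, hy, rfl⟩
      rw [mem_quaternionPart] at hy
      rw [hcomm z z' hz, hcomm h 1 hfix, hy.1, hy.2, map_neg]
      exact ⟨rfl, rfl⟩
    · rintro ⟨h1, h2⟩
      let X : ClassGroup (𝓞 E) := x.toMul
      have hXp : X ^ p = 1 := x.pow_eq_one
      have hX : classGroupAction (𝓞 E) Γ h X = X :=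
        congrArg (fun y : PTorsion (ClassGroup (𝓞 E)) p => (y.toMul : ClassGroup (𝓞 E))) h2
      have hH : ∀ g : Subgroup.zpowers h,
          classGroupAction (𝓞 E) (Subgroup.zpowers h) g X = X := by
        rintro ⟨g, hg⟩
        have hg' : classGroupAction (𝓞 E) Γ g X = X := by
          rw [← mem_powers_iff_mem_zpowers] at hg
          obtain ⟨n, rfl⟩ := hg
          induction n with
          | zero =>
            change classGroupAction (𝓞 E) Γ (h ^ 0) X = X
            rw [pow_zero, classGroupAction_one]
          | succ n ih =>
            change classGroupAction (𝓞 E) Γ (h ^ (n + 1)) X = X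
            rw [pow_succ, classGroupAction_mul, hX]
            exact ih
        exact (ClassGroup.extendAlong_congr _ (smul_toRingHom_injective Γ g)
          (fun _ => rfl) X).trans hg'
      -- A fixed class `X` has norm extending to `X^|⟨h⟩|`; with `m` inverse to `|⟨h⟩|` mod `p`, the
      -- class `N(X)^m` extends to `X`.
      obtain ⟨m, -, hm⟩ := Nat.exists_mul_mod_eq_one_of_coprime hp (Fact.out : p.Prime).one_lt
      have hnorm := classGroupExtend_norm F E (Subgroup.zpowers h) X
      replace hnorm := hnorm.trans (Finset.prod_eq_pow_card (fun g _ => hH g))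
      rw [Finset.card_univ, ← Nat.card_eq_fintype_card] at hnorm
      have hy : (classGroupNorm F E X ^ m) ^ p = 1 := by
        rw [← pow_mul, mul_comm, pow_mul, ← map_pow, hXp, map_one, one_pow]
      have hJy : J (PTorsion.mk _ hy) = x := by
        apply PTorsion.ext
        change classGroupExtend F E (classGroupNorm F E X ^ m) = X
        rw [map_pow, hnorm, ← pow_mul, pow_eq_pow_mod _ hXp, hm, pow_one]
      refine ⟨PTorsion.mk _ hy, mem_quaternionPart.2 ⟨hJ ?_, by rw [map_one]; rfl⟩, hJy⟩
      rw [← hcomm z z' hz, map_neg, hJy, h1]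
  rw [← hmap]
  exact LinearEquiv.finrank_eq (Submodule.equivMapOfInjective J hJ _).symm

end Torsion

/-! ### Inertia groups and generation of Galois groups over `ℚ`. -/

section Inertia

/-- If `H` contains all inertia groups, `E` over the fixed field of `H` absorbs all the ramification
of `E/ℚ`. The fixed field is then unramified over `ℚ`, hence equal to `ℚ` by Minkowski's theorem. -/
theorem eq_top_of_inertia_le (E : Type*) [Field E] [NumberField E] [IsGalois ℚ E]
    (H : Subgroup Gal(E/ℚ))
    (hH : ∀ P : Ideal (𝓞 E), P.IsPrime → P ≠ ⊥ → P.inertia Gal(E/ℚ) ≤ H) : H = ⊤ := by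
  let M := IntermediateField.fixedField H
  have hgal : IsGaloisGroup H M E := IsGaloisGroup.of_fixedPoints_eq Gal(E/ℚ) ℚ E H M rfl
  suffices hM : Module.finrank ℚ M = 1 by
    have h1 := IsGaloisGroup.card_eq_finrank H M E
    have h2 := IsGaloisGroup.card_eq_finrank Gal(E/ℚ) ℚ E
    rw [← Module.finrank_mul_finrank ℚ M E, hM, one_mul, ← h1] at h2
    exact Subgroup.eq_top_of_card_eq H h2.symm
  by_contra hM
  obtain ⟨p, hp, hunr⟩ := NumberField.exists_not_isUnramifiedAt_int (K := M) (𝒪 := 𝓞 M) hM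
  apply hunr
  obtain ⟨P, hP, hPp⟩ := Ideal.exists_maximal_ideal_liesOver_of_isIntegral (S := 𝓞 E) p
  have hp0 : p ≠ ⊥ := Ring.ne_bot_of_isMaximal_of_not_isField hp
    (NumberField.RingOfIntegers.not_isField M)
  have hP0 : P ≠ ⊥ := Ideal.ne_bot_of_liesOver_of_ne_bot hp0 P
  have hq : P.LiesOver (p.under ℤ) := Ideal.LiesOver.trans P p _
  have hgal' : IsGaloisGroup H (𝓞 M) (𝓞 E) := IsGaloisGroup.of_isFractionRing H (𝓞 M) (𝓞 E) M E
  have h1 := Ideal.card_inertia_eq_ramificationIdxIn (G := Gal(E/ℚ)) (p.under ℤ) P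
  have h2 := Ideal.card_inertia_eq_ramificationIdxIn (G := H) p P
  rw [Ideal.ramificationIdxIn_eq_ramificationIdx (p.under ℤ) P Gal(E/ℚ)] at h1
  rw [Ideal.ramificationIdxIn_eq_ramificationIdx p P H] at h2
  have h3 : Nat.card (P.inertia H) = Nat.card (P.inertia Gal(E/ℚ)) :=
    Nat.card_congr (Subgroup.subgroupOfEquivOfLe (hH P hP.isPrime hP0)).toEquiv
  have h4 := Ideal.ramificationIdx_tower (R := ℤ) p P
  rw [← h1, ← h2, h3] at h4
  rw [← Ideal.ramificationIdx_eq_one_iff]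
  exact Nat.eq_of_mul_eq_mul_right Nat.card_pos (h4.symm.trans (one_mul _).symm)

theorem inertia_eq_bot_of_ramificationIdx_eq_one (k E : Type*) [Field k] [NumberField k] [Field E]
    [NumberField E] [Algebra k E] [IsGalois k E] (P : Ideal (𝓞 E)) [P.IsMaximal]
    (hP : P.ramificationIdx (𝓞 k) = 1) : P.inertia Gal(E/k) = ⊥ := by
  have h := Ideal.card_inertia_eq_ramificationIdxIn (G := Gal(E/k)) (P.under (𝓞 k)) P
  rw [Ideal.ramificationIdxIn_eq_ramificationIdx (P.under (𝓞 k)) P Gal(E/k), hP] at h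
  exact Subgroup.card_eq_one.1 h

theorem ramificationIdx_eq_one_of_unramified (k E L : Type*) [Field k] [NumberField k] [Field E]
    [NumberField E] [Field L] [NumberField L] [Algebra k E] [Algebra k L] [Algebra E L]
    [IsScalarTower k E L] [Algebra.Unramified (𝓞 k) (𝓞 L)] (P : Ideal (𝓞 E)) [P.IsMaximal] :
    P.ramificationIdx (𝓞 k) = 1 := by
  obtain ⟨Q, hQ, hQP⟩ := Ideal.exists_maximal_ideal_liesOver_of_isIntegral (S := 𝓞 L) P
  have h := Ideal.ramificationIdx_tower (R := 𝓞 k) P Q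
  rw [Ideal.ramificationIdx_eq_one Q (𝓞 k)] at h
  exact Nat.eq_one_of_mul_eq_one_right h.symm

theorem index_range_restrictScalarsHom (k E : Type*) [Field k] [NumberField k] [Field E]
    [NumberField E] [Algebra k E] [IsGalois k E] [IsGalois ℚ E] :
    (AlgEquiv.restrictScalarsHom ℚ : Gal(E/k) →* Gal(E/ℚ)).range.index = Module.finrank ℚ k := by
  have h := (AlgEquiv.restrictScalarsHom ℚ : Gal(E/k) →* Gal(E/ℚ)).range.index_mul_card
  rw [Nat.card_congr (MonoidHom.ofInjective
    (AlgEquiv.restrictScalarsHom_injective ℚ)).symm.toEquiv,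
    IsGalois.card_aut_eq_finrank, IsGalois.card_aut_eq_finrank,
    ← Module.finrank_mul_finrank ℚ k E] at h
  exact Nat.eq_of_mul_eq_mul_right Module.finrank_pos h

/-- Inertia groups over `ℚ` meet `Gal(E/k)` trivially and generate. The square of any inertia
element lies in the index-two subgroup `Gal(E/k)`, so it is `1`. -/
theorem closure_involutions_eq_top (k E : Type*) [Field k] [NumberField k] [Field E]
    [NumberField E] [Algebra k E] [IsGalois k E] [IsGalois ℚ E] (hk : Module.finrank ℚ k = 2)
    (hunr : ∀ P : Ideal (𝓞 E), P.IsMaximal → P.ramificationIdx (𝓞 k) = 1) :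
    Subgroup.closure {σ : Gal(E/ℚ) |
      σ ∉ (AlgEquiv.restrictScalarsHom ℚ : Gal(E/k) →* Gal(E/ℚ)).range ∧ σ * σ = 1} = ⊤ := by
  apply eq_top_of_inertia_le
  intro P hP hP0 σ hσ
  have hmax : P.IsMaximal := hP.isMaximal hP0
  have hbot := inertia_eq_bot_of_ramificationIdx_eq_one k E P (hunr P hmax)
  have hone : ∀ τ ∈ P.inertia Gal(E/ℚ),
      τ ∈ (AlgEquiv.restrictScalarsHom ℚ : Gal(E/k) →* Gal(E/ℚ)).range → τ = 1 := by
    rintro _ hτ ⟨τ, rfl⟩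
    have : τ ∈ P.inertia Gal(E/k) := hτ
    rw [hbot, Subgroup.mem_bot] at this
    rw [this, map_one]
  by_cases hσr : σ ∈ (AlgEquiv.restrictScalarsHom ℚ : Gal(E/k) →* Gal(E/ℚ)).range
  · rw [hone σ hσ hσr]
    exact one_mem _
  · refine Subgroup.subset_closure ⟨hσr, hone _ (mul_mem hσ hσ) ?_⟩
    exact Subgroup.mul_self_mem_of_index_two
      ((index_range_restrictScalarsHom k E).trans hk) σ

end Inertia

/-! ### The class group of a quaternion extension normal over `ℚ`. -/

section QuaternionExtension

theorem dim_quaternionPart_dvd (k E : Type*) [Field k] [NumberField k] [Field E]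
    [NumberField E] [Algebra k E] [IsGalois k E] [IsGalois ℚ E] (hk : Module.finrank ℚ k = 2)
    (hunr : ∀ P : Ideal (𝓞 E), P.IsMaximal → P.ramificationIdx (𝓞 k) = 1)
    (e : Gal(E/k) ≃* QuaternionGroup 2) (z : Gal(E/k)) (hz : e z = .a 2)
    (p : ℕ) [Fact p.Prime] (hp : p ≠ 2) :
    2 ∣ (quaternionPart (pTorsionAction (𝓞 E) Gal(E/ℚ) p)
        (AlgEquiv.restrictScalarsHom ℚ z) 1).dim ∧
      (¬ IsSquare (-1 : ZMod p) → 4 ∣ (quaternionPart (pTorsionAction (𝓞 E) Gal(E/ℚ) p)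
        (AlgEquiv.restrictScalarsHom ℚ z) 1).dim) := by
  let r : Gal(E/k) →* Gal(E/ℚ) := AlgEquiv.restrictScalarsHom ℚ
  let f : QuaternionGroup 2 →* Gal(E/ℚ) := r.comp e.symm.toMonoidHom
  have hrange : f.range = r.range := by
    rw [MonoidHom.range_comp, MonoidHom.range_eq_top.2 e.symm.surjective, ← MonoidHom.range_eq_map]
  have hf : Function.Injective f :=
    (AlgEquiv.restrictScalarsHom_injective ℚ).comp e.symm.injective
  obtain ⟨τ, hττ, hτ⟩ := exists_sq_eq_and_commute_of_closure_involutions f hf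
    (by rw [hrange, index_range_restrictScalarsHom, hk])
    (by rw [hrange]; exact closure_involutions_eq_top k E hk hunr)
  have hfz : r z = f (.a 2) := by
    rw [← hz]
    exact congrArg r (e.symm_apply_apply z).symm
  change 2 ∣ (quaternionPart (pTorsionAction (𝓞 E) Gal(E/ℚ) p) (r z) 1).dim ∧
      (¬ IsSquare (-1 : ZMod p) →
        4 ∣ (quaternionPart (pTorsionAction (𝓞 E) Gal(E/ℚ) p) (r z) 1).dim)
  rw [hfz]
  let ρ := pTorsionAction (𝓞 E) Gal(E/ℚ) p
  have hρ : ∀ g h x, ρ (g * h) x = ρ g (ρ h x) := fun g h x => by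
    rw [map_mul, Module.End.mul_apply]
  have hcen : ∀ q : QuaternionGroup 2, .a 2 * q = q * .a 2 := by decide
  have hcomm : ∀ g ∈ ({τ, f (.a 1) * τ, f (.xa 0)} : Set Gal(E/ℚ)),
      f (.a 2) * g = g * f (.a 2) := by
    rintro g (rfl | rfl | rfl)
    · exact (hτ _).symm
    · rw [mul_assoc, hτ, ← mul_assoc, ← mul_assoc, ← map_mul, hcen, map_mul]
    · rw [← map_mul, hcen, map_mul]
  have : Module.Finite (ZMod p) (PTorsion (ClassGroup (𝓞 E)) p) := Module.Finite.of_finite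
  -- With `i = .a 1` and `j = .xa 0`, `(iτ)² = i²τ² = 1` since `τ` centralizes `Q₈`. Moreover `iτ`
  -- and `j` commute up to `.a 2`, which acts as `-1`.
  refine finrank_dvd_of_relations (zmod_two_ne_zero hp) ρ _ τ (f (.a 1) * τ) (f (.xa 0))
    (fun g hg x hx => ?_) (fun x hx => ?_) (fun x hx => ?_) (fun x hx => ?_) (fun x hx => ?_)
  · rw [mem_quaternionPart] at hx ⊢
    refine ⟨?_, by rw [map_one]; rfl⟩
    change ρ _ (ρ g x) = _
    rw [← hρ, hcomm g hg, hρ]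
    exact (congrArg (ρ g) hx.1).trans (map_neg _ _)
  · rw [hττ]
    exact (mem_quaternionPart.1 hx).1
  · have : f (.a 1) * τ * (f (.a 1) * τ) = 1 := by
      calc f (.a 1) * τ * (f (.a 1) * τ) = f (.a 1) * (τ * f (.a 1)) * τ := by group
        _ = f (.a 1) * f (.a 1) * (τ * τ) := by rw [hτ]; group
        _ = 1 := by
          rw [hττ, ← map_mul, ← map_mul, ← map_one f]
          exact congrArg f (by decide)
    rw [this, map_one, Module.End.one_apply]
  · rw [← mul_assoc, hτ]
  · have : f (.a 1) * τ * f (.xa 0) = f (.xa 0) * (f (.a 1) * τ) * f (.a 2) := by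
      rw [mul_assoc, hτ, mul_assoc, mul_assoc, hτ, ← mul_assoc, ← mul_assoc, ← mul_assoc,
        ← map_mul, ← map_mul, ← map_mul]
      exact congrArg (fun q => f q * τ) (by decide)
    rw [this, hρ]
    exact (congrArg (ρ _) (mem_quaternionPart.1 hx).1).trans (map_neg _ _)

end QuaternionExtension

/-! ### Quaternion quotients and the commutator subgroup of the group `32.40`. -/

namespace Group32_40

/-- The quotient of `Group32_40` by the subgroup of order four generated by `c z ^ ε`. -/
def toQuaternionGroup (ε : ZMod 2) : Group32_40 →* QuaternionGroup 2 :=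
  MonoidHom.mk'
    -- Thus `a ↦ .a 1`, `b ↦ .xa 0`, `z ↦ .a 2`, `w ↦ 1` and `c ↦ (.a 2)^ε`.
    (fun x => .xa 0 ^ x.j.val * .a 1 ^ x.i.val * .a 2 ^ (x.s + ε * x.l).val)
    (by decide +revert)

theorem toQuaternionGroup_surjective (ε : ZMod 2) :
    Function.Surjective (toQuaternionGroup ε) := by
  have h : ∀ (ε : ZMod 2) (q : QuaternionGroup 2), ∃ x : Group32_40,
      (.xa 0 ^ x.j.val * .a 1 ^ x.i.val * .a 2 ^ (x.s + ε * x.l).val : QuaternionGroup 2) = q := by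
    decide
  exact h ε

theorem ker_toQuaternionGroup (ε : ZMod 2) :
    (toQuaternionGroup ε).ker = Subgroup.zpowers ⟨0, 0, 1, ε, 0⟩ := by
  apply le_antisymm
  · have h : ∀ (ε : ZMod 2) (x : Group32_40),
        (.xa 0 ^ x.j.val * .a 1 ^ x.i.val * .a 2 ^ (x.s + ε * x.l).val : QuaternionGroup 2) = 1 →
        ∃ n : Fin 4, (⟨0, 0, 1, ε, 0⟩ : Group32_40) ^ (n : ℕ) = x := by
      decide
    intro x hx
    obtain ⟨n, hn⟩ := h ε x hx
    exact hn ▸ Subgroup.pow_mem _ (Subgroup.mem_zpowers _) _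
  · rw [Subgroup.zpowers_le, MonoidHom.mem_ker]
    have h : ∀ ε : ZMod 2, (.xa 0 ^ (0 : ZMod 2).val * .a 1 ^ (0 : ZMod 2).val *
        .a 2 ^ (ε + ε * 1).val : QuaternionGroup 2) = 1 := by decide
    exact h ε

open scoped commutatorElement in
theorem mem_commutator_iff (x : Group32_40) :
    x ∈ commutator Group32_40 ↔ x.i = 0 ∧ x.j = 0 ∧ x.l = 0 := by
  constructor
  · intro hx
    let D : Subgroup Group32_40 :=
      { carrier := {x | x.i = 0 ∧ x.j = 0 ∧ x.l = 0}
        one_mem' := ⟨rfl, rfl, rfl⟩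
        mul_mem' := by
          rintro x y ⟨h1, h2, h3⟩ ⟨h4, h5, h6⟩
          simp [mul_def, h1, h2, h3, h4, h5, h6]
        inv_mem' := by
          rintro x ⟨h1, h2, h3⟩
          simp [inv_def, h1, h2, h3] }
    have hle : commutator Group32_40 ≤ D := by
      rw [commutator_def, Subgroup.commutator_le]
      rintro x - y -
      have h : ∀ a b : ZMod 2, a + b + a + b = 0 := by decide
      simp [D, commutatorElement_def, mul_def, inv_def, h]
    exact hle hx
  -- Each `z^s w^t` is a single commutator of `a` with an element of `⟨b, c⟩`.
  · have h : ∀ x : Group32_40, x.i = 0 ∧ x.j = 0 ∧ x.l = 0 →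
        ∃ j l : ZMod 2, x = ⁅(⟨1, 0, 0, 0, 0⟩ : Group32_40), ⟨0, j, l, 0, 0⟩⁆ := by decide
    intro hx
    obtain ⟨j, l, rfl⟩ := h x hx
    rw [commutator_def]
    exact Subgroup.commutator_mem_commutator (Subgroup.mem_top _) (Subgroup.mem_top _)

theorem mem_commutator_iff_of_mulEquiv {G : Type*} [Group G] (φ : G ≃* Group32_40) (g : G) :
    g ∈ commutator G ↔ (φ g).i = 0 ∧ (φ g).j = 0 ∧ (φ g).l = 0 := by
  have h : (commutator G).map φ.toMonoidHom = commutator Group32_40 := by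
    rw [commutator_def, Subgroup.map_commutator, Subgroup.map_top_of_surjective _ φ.surjective,
      commutator_def]
  rw [← mem_commutator_iff, ← h]
  exact (Subgroup.mem_map_iff_mem φ.injective).symm

/-- The elements of the commutator subgroup of a group isomorphic to `Group32_40`. -/
noncomputable def commutatorEquiv {G : Type*} [Group G] (φ : G ≃* Group32_40) :
    ZMod 2 × ZMod 2 ≃ commutator G where
  toFun st := ⟨φ.symm ⟨0, 0, 0, st.1, st.2⟩, by
    rw [mem_commutator_iff_of_mulEquiv φ, φ.apply_symm_apply]
    exact ⟨rfl, rfl, rfl⟩⟩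
  invFun g := ((φ g).s, (φ g).t)
  left_inv st := by simp
  right_inv g := by
    obtain ⟨h1, h2, h3⟩ := (mem_commutator_iff_of_mulEquiv φ _).1 g.2
    apply Subtype.ext
    change φ.symm _ = (g : G)
    rw [MulEquiv.symm_apply_eq]
    exact Group32_40.ext h1.symm h2.symm h3.symm rfl rfl

theorem ker_sum_commutator {G F V : Type*} [Group G] [Field F] [AddCommGroup V] [Module F V]
    (φ : G ≃* Group32_40) (ρ : G →* Module.End F V) [Fintype (commutator G)] :
    LinearMap.ker (∑ g : commutator G, ρ g) = normKer (ρ.comp φ.symm.toMonoidHom) := by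
  rw [normKer, ← (commutatorEquiv φ).sum_comp, Fintype.sum_prod_type]
  have h (f : ZMod 2 → Module.End F V) : ∑ s, f s = f 0 + f 1 := Fin.sum_univ_two f
  rw [h, h, h]
  have h1 : (ρ.comp φ.symm.toMonoidHom) ⟨0, 0, 0, 0, 0⟩ = 1 := map_one _
  rw [← h1]
  congr 1
  change _ + _ + (_ + _) = _
  rw [← add_assoc]
  exact congrArg (· + _) (add_right_comm _ _ _)

end Group32_40

/-! ### Assembly: the quaternion subextensions of `L/k` and the congruences. -/

theorem dim_quaternionPart_dvd_of_unramified {k L : Type*} [Field k] [NumberField k] [Field L]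
    [NumberField L] [Algebra k L] [IsGalois k L] (hk : Module.finrank ℚ k = 2)
    (hunr : Algebra.Unramified (𝓞 k) (𝓞 L)) (φ : Gal(L/k) ≃* Group32_40)
    (hquat : ∀ E : IntermediateField k L, IsGalois k E →
      Nonempty (Gal(E/k) ≃* QuaternionGroup 2) → Normal ℚ E)
    (p : ℕ) [Fact p.Prime] (hp : p ≠ 2) (ε : ZMod 2) :
    2 ∣ (quaternionPart (pTorsionAction (𝓞 L) Gal(L/k) p)
        (φ.symm ⟨0, 0, 0, 1, 0⟩) (φ.symm ⟨0, 0, 1, ε, 0⟩)).dim ∧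
      (¬ IsSquare (-1 : ZMod p) → 4 ∣ (quaternionPart (pTorsionAction (𝓞 L) Gal(L/k) p)
        (φ.symm ⟨0, 0, 0, 1, 0⟩) (φ.symm ⟨0, 0, 1, ε, 0⟩)).dim) := by
  let z : Gal(L/k) := φ.symm ⟨0, 0, 0, 1, 0⟩
  let h : Gal(L/k) := φ.symm ⟨0, 0, 1, ε, 0⟩
  let π : Gal(L/k) →* QuaternionGroup 2 := (Group32_40.toQuaternionGroup ε).comp φ.toMonoidHom
  have hπ : Function.Surjective π :=
    (Group32_40.toQuaternionGroup_surjective ε).comp φ.surjective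
  have hker : π.ker = Subgroup.zpowers h := by
    rw [← MonoidHom.comap_ker, Group32_40.ker_toQuaternionGroup]
    change Subgroup.comap (φ : Gal(L/k) →* Group32_40) _ = _
    rw [Subgroup.comap_equiv_eq_map_symm, MonoidHom.map_zpowers]
    rfl
  have hπz : π z = .a 2 := by
    change Group32_40.toQuaternionGroup ε (φ (φ.symm _)) = _
    rw [φ.apply_symm_apply]
    have : ∀ ε : ZMod 2, (.xa 0 ^ (0 : ZMod 2).val * .a 1 ^ (0 : ZMod 2).val *
        .a 2 ^ (1 + ε * 0).val : QuaternionGroup 2) = .a 2 := by decide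
    exact this ε
  have hnormal : (Subgroup.zpowers h).Normal := hker ▸ π.normal_ker
  let E : IntermediateField k L := IntermediateField.fixedField (Subgroup.zpowers h)
  have hfix : E.fixingSubgroup = Subgroup.zpowers h :=
    IntermediateField.fixingSubgroup_fixedField _
  have hEk : IsGalois k E := IsGalois.of_fixedField_normal_subgroup (Subgroup.zpowers h)
  have hEL : IsGaloisGroup (Subgroup.zpowers h) E L :=
    IsGaloisGroup.of_fixedPoints_eq Gal(L/k) k L _ E rfl
  let res : Gal(L/k) →* Gal(E/k) := AlgEquiv.restrictNormalHom E
  have hres : Function.Surjective res := AlgEquiv.restrictNormalHom_surjective L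
  have hreskernel : res.ker = π.ker := by
    rw [hker, ← hfix]
    exact IntermediateField.restrictNormalHom_ker E
  -- Built from `π` so that `e (res g) = π g`; this pins the restriction of `z` to the central
  -- element `.a 2`.
  let e : Gal(E/k) ≃* QuaternionGroup 2 :=
    (QuotientGroup.quotientKerEquivOfSurjective res hres).symm.trans
      ((QuotientGroup.quotientMulEquivOfEq hreskernel).trans
        (QuotientGroup.quotientKerEquivOfSurjective π hπ))
  have he : ∀ g, e (res g) = π g := by
    intro g
    change QuotientGroup.quotientKerEquivOfSurjective π hπ
      (QuotientGroup.quotientMulEquivOfEq hreskernel ((QuotientGroup.quotientKerEquivOfSurjective res hres).symm (res g))) = _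
    have : (QuotientGroup.quotientKerEquivOfSurjective res hres).symm (res g) =
        (g : _ ⧸ res.ker) := by
      rw [MulEquiv.symm_apply_eq]
      rfl
    rw [this]
    rfl
  have hnormQ : Normal ℚ E := hquat E hEk ⟨e⟩
  have hEQ : IsGalois ℚ E := ⟨⟩
  have hcard : Nat.card (Subgroup.zpowers h) ∣ 4 := by
    rw [Nat.card_zpowers]
    apply orderOf_dvd_of_pow_eq_one
    have : ∀ ε : ZMod 2, (⟨0, 0, 1, ε, 0⟩ : Group32_40) ^ 4 = 1 := by decide
    rw [← map_pow, this, map_one]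
  have hcop : (Nat.card (Subgroup.zpowers h)).Coprime p := by
    refine Nat.Coprime.coprime_dvd_left hcard ?_
    rw [show (4 : ℕ) = 2 ^ 2 by norm_num]
    exact Nat.Coprime.pow_left 2 ((Nat.coprime_primes Nat.prime_two Fact.out).2 hp.symm)
  have hmain := dim_quaternionPart_dvd k E hk
    (fun P hP => ramificationIdx_eq_one_of_unramified k E L P) e (res z)
    ((he z).trans hπz) p hp
  rwa [← dim_quaternionPart_eq E L p h hcop z (AlgEquiv.restrictScalarsHom ℚ (res z))
    (fun x => ?_)] at hmain
  apply NumberField.RingOfIntegers.ext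
  exact (AlgEquiv.restrictNormal_commutes z E (x : E)).symm

theorem corollary20 {k L : Type*} [Field k] [NumberField k] [Field L] [NumberField L]
    [Algebra k L] [IsGalois k L]
    (hk : Module.finrank ℚ k = 2)
    (hunr : Algebra.Unramified (𝓞 k) (𝓞 L))
    (hΓ : Nonempty (Gal(L/k) ≃* Group32_40))
    (hquat : ∀ E : IntermediateField k L, IsGalois k E →
      Nonempty (Gal(E/k) ≃* QuaternionGroup 2) → Normal ℚ E)
    (K : IntermediateField k L)
    (hK : K = IntermediateField.fixedField (commutator Gal(L/k)))
    (p : ℕ) (hp : p.Prime) :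
    (p ≡ 1 [MOD 4] → 2 ∣ Group.rank (relClassGroupPart K L p)) ∧
      (p ≡ 3 [MOD 4] → 4 ∣ Group.rank (relClassGroupPart K L p)) := by
  classical
  have : Fact p.Prime := ⟨hp⟩
  obtain ⟨φ⟩ := hΓ
  by_cases hp2 : p = 2
  · subst hp2
    exact ⟨fun h => absurd h (by decide), fun h => absurd h (by decide)⟩
  have hKL : IsGaloisGroup (commutator Gal(L/k)) K L :=
    IsGaloisGroup.of_fixedPoints_eq Gal(L/k) k L _ K hK.symm
  have hcop : (Nat.card (commutator Gal(L/k))).Coprime p := by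
    rw [← Nat.card_congr (Group32_40.commutatorEquiv φ), Nat.card_prod, Nat.card_zmod]
    have h := (Nat.coprime_primes Nat.prime_two hp).2 (Ne.symm hp2)
    exact Nat.Coprime.mul_left h h
  have : Fintype (commutator Gal(L/k)) := Fintype.ofFinite _
  rw [rank_relClassGroupPart_of_subgroup K L p (commutator Gal(L/k)) hcop,
    Group32_40.ker_sum_commutator φ]
  have : Module.Finite (ZMod p) (PTorsion (ClassGroup (𝓞 L)) p) := Module.Finite.of_finite
  have hmain := Group32_40.finrank_normKer_dvd (zmod_two_ne_zero hp2)
    ((pTorsionAction (𝓞 L) Gal(L/k) p).comp φ.symm.toMonoidHom) (by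
      rintro h (rfl | rfl)
      · exact dim_quaternionPart_dvd_of_unramified hk hunr φ hquat p hp2 0
      · exact dim_quaternionPart_dvd_of_unramified hk hunr φ hquat p hp2 1)
  refine ⟨fun _ => hmain.1, fun h3 => hmain.2 ?_⟩
  -- `-1` is a square modulo `p` exactly when `p` is not `3` mod `4`.
  rw [ZMod.exists_sq_eq_neg_one_iff]
  exact not_not.2 h3
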